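/- Let $d\ge 1$, $R>0$, $h>0$. Let $\mathrm{SP}(z)=\big(R\,z_i/(1-z_{d+1})\big)_{1\le i\le d}$ be the stereographic projection of $\mathbb S^d\subset\mathbb R^{d+1}$ (minus its north pole) onto $\mathbb R^d$. Let $\pi$ be a probability density on $\mathbb R^d$, and let $\pi_S(z)\propto \pi(x)(R^2+\|x\|^2)^d$, $x=\mathrm{SP}(z)$, be the corresponding probability density on $\mathbb S^d$ with respect to the surface measure. For $z\in\mathbb S^d$ let $Q_S(z,\cdot)$ be the law of $(z+v)/\|z+v\|$, where $v=\xi-(z^T\xi)z$ and $\xi\sim\mathcal N(0,h^2I_{d+1})$; write $Q_S(z,\hat z)$ also for its density with respect to the surface measure. Let $\omega:\mathbb S^d\times\mathbb S^d\to[0,\infty)$ be a measurable weight function. For $N\ge1$, the SMTM chain $(X_N(m))_{m\ge0}$ with $N$ candidates is the Markov chain on $\mathbb R^d$ with the following transition from $x$. Put $z=\mathrm{SP}^{-1}(x)$; draw $\hat z_1,\dots,\hat z_N$ independently from $Q_S(z,\cdot)$; select $\hat z_j$ with probability $\omega(z,\hat z_j)/\sum_{i=1}^N\omega(z,\hat z_i)$;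 draw $z_1^*,\dots,z_{N-1}^*$ independently from $Q_S(\hat z_j,\cdot)$; move to $\mathrm{SP}(\hat z_j)$ with probability $$1\wedge\frac{\pi_S(\hat z_j)\,\omega(\hat z_j,z)\big/\big(\sum_{i=1}^{N-1}\omega(\hat z_j,z_i^*)+\omega(\hat z_j,z)\big)}{\pi_S(z)\,\omega(z,\hat z_j)\big/\sum_{i=1}^{N}\omega(z,\hat z_i)},$$ and otherwise stay at $x$. The ideal scheme $(X_\infty(m))_{m\ge0}$ is the Markov chain on $\mathbb R^d$ with the following transition from $x$. Put $z=\mathrm{SP}^{-1}(x)$; draw $\hat z$ from the density $$Q_\infty(z,\hat z)=\frac{\omega(z,\hat z)\,Q_S(z,\hat z)}{\int_{\mathbb S^d}\omega(z,y)\,Q_S(z,y)\,dy};$$ move to $\mathrm{SP}(\hat z)$ with probability $1\wedge\frac{\pi_S(\hat z)Q_\infty(\hat z,z)}{\pi_S(z)Q_\infty(z,\hat z)}$, and otherwise stay at $x$. **Theorem.** Assume that $\mathbb E[\omega(Z,\hat Z)^4]<\infty$ and $\mathbb E[\omega(Z,\hat Z)^{-4}]<\infty$, where $Z\sim\pi_S$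 and $\hat Z\mid Z\sim Q_S(Z,\cdot)$ (with $0^{-4}=\infty$). If $X_N(0)\sim\pi$ for all $N$ and $X_\infty(0)\sim\pi$, then, as $N\to\infty$, the process $(X_N(m))_{m\ge0}$ converges weakly to $(X_\infty(m))_{m\ge0}$, as random elements of $(\mathbb R^d)^{\mathbb N}$ with the product topology. -/

import Mathlib

open MeasureTheory ProbabilityTheory Filter Topology
open scoped ENNReal NNReal

namespace SMTM

/-- The Euclidean space `ℝ^n`. -/
abbrev Euc (n : ℕ) : Type := EuclideanSpace ℝ (Fin n)

/-- The unit sphere `𝕊^d` of `ℝ^(d+1)`. -/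
abbrev Sph (d : ℕ) : Type := Metric.sphere (0 : Euc (d + 1)) 1

/-- The surface measure of the unit sphere `𝕊^d`. -/
noncomputable def surface (d : ℕ) : Measure (Sph d) :=
  (volume : Measure (Euc (d + 1))).toSphere

instance (d : ℕ) : IsFiniteMeasure (surface d) := by
  unfold surface; infer_instance

section Stereographic

/-- Stereographic projection `z ↦ (R zᵢ / (1 - z_{d+1}))ᵢ`, with the value `0` at the north pole
(where the formula divides by zero). -/
noncomputable def stereo {d : ℕ} (R : ℝ) (z : Sph d) : Euc d :=
  WithLp.toLp 2 fun i : Fin d =>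
    R * (z : Euc (d + 1)) i.castSucc / (1 - (z : Euc (d + 1)) (Fin.last d))

/-- The vector of `ℝ^(d+1)` underlying the inverse stereographic projection. -/
noncomputable def stereoInvVec {d : ℕ} (R : ℝ) (x : Euc d) : Euc (d + 1) :=
  WithLp.toLp 2 (Fin.snoc (α := fun _ => ℝ) (fun i : Fin d => 2 * R * x i / (‖x‖ ^ 2 + R ^ 2))
    ((‖x‖ ^ 2 - R ^ 2) / (‖x‖ ^ 2 + R ^ 2)))

theorem stereoInvVec_mem {d : ℕ} {R : ℝ} (hR : 0 < R) (x : Euc d) :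
    stereoInvVec R x ∈ Metric.sphere (0 : Euc (d + 1)) 1 := by
  have hx : ‖x‖ ^ 2 = ∑ i, (x i) ^ 2 := EuclideanSpace.real_norm_sq_eq x
  have hpos : 0 < ‖x‖ ^ 2 + R ^ 2 := by positivity
  have h : ‖stereoInvVec R x‖ ^ 2 = 1 := by
    rw [EuclideanSpace.real_norm_sq_eq, Fin.sum_univ_castSucc]
    simp only [stereoInvVec, Fin.snoc_castSucc, Fin.snoc_last]
    have : ∑ i : Fin d, (2 * R * x i / (‖x‖ ^ 2 + R ^ 2)) ^ 2
        = (2 * R / (‖x‖ ^ 2 + R ^ 2)) ^ 2 * ‖x‖ ^ 2 := by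
      rw [hx, Finset.mul_sum]
      refine Finset.sum_congr rfl fun i _ => ?_
      ring
    rw [this]
    field_simp
    ring
  rw [mem_sphere_zero_iff_norm]
  have h0 := norm_nonneg (stereoInvVec R x)
  nlinarith

/-- Inverse stereographic projection `ℝ^d → 𝕊^d`. -/
noncomputable def stereoInv {d : ℕ} {R : ℝ} (hR : 0 < R) (x : Euc d) : Sph d :=
  ⟨stereoInvVec R x, stereoInvVec_mem hR x⟩

theorem measurable_stereoInv {d : ℕ} {R : ℝ} (hR : 0 < R) :
    Measurable (stereoInv (d := d) hR) := by
  refine Measurable.subtype_mk ?_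
  refine (WithLp.measurable_toLp 2 _).comp ?_
  refine measurable_pi_lambda _ fun i => ?_
  refine Fin.lastCases ?_ (fun j => ?_) i
  · simp only [Fin.snoc_last]; fun_prop
  · simp only [Fin.snoc_castSucc]; fun_prop

end Stereographic

section Proposal

/-- The tangential part `ξ - (zᵀξ) z / ‖z‖²` of `ξ` at `z`. -/
noncomputable def tangentPart {d : ℕ} (z : Sph d) (ξ : Euc (d + 1)) : Euc (d + 1) :=
  ξ - (inner ℝ (z : Euc (d + 1)) ξ / ‖(z : Euc (d + 1))‖ ^ 2) • (z : Euc (d + 1))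

theorem add_tangentPart_ne_zero {d : ℕ} (z : Sph d) (ξ : Euc (d + 1)) :
    (z : Euc (d + 1)) + tangentPart z ξ ≠ 0 := by
  intro h0
  have hz : ‖(z : Euc (d + 1))‖ = 1 := by simp
  have h1 : inner ℝ (z : Euc (d + 1)) ((z : Euc (d + 1)) + tangentPart z ξ) = 1 := by
    simp only [tangentPart, inner_add_right, inner_sub_right, inner_smul_right,
      real_inner_self_eq_norm_sq, hz]
    ring
  rw [h0, inner_zero_right] at h1
  exact zero_ne_one h1

/-- One random walk move on the sphere: move from `z` by the tangential part of `ξ` and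
renormalise. -/
noncomputable def sphereStep {d : ℕ} (z : Sph d) (ξ : Euc (d + 1)) : Sph d :=
  ⟨‖(z : Euc (d + 1)) + tangentPart z ξ‖⁻¹ • ((z : Euc (d + 1)) + tangentPart z ξ), by
    rw [mem_sphere_zero_iff_norm, norm_smul, norm_inv, norm_norm]
    exact inv_mul_cancel₀ (norm_ne_zero_iff.mpr (add_tangentPart_ne_zero z ξ))⟩

theorem measurable_sphereStep {d : ℕ} :
    Measurable fun p : Sph d × Euc (d + 1) => sphereStep p.1 p.2 := by
  unfold sphereStep tangentPart
  refine Measurable.subtype_mk ?_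
  fun_prop

theorem measurable_sphereStep_right {d : ℕ} (z : Sph d) : Measurable (sphereStep z) := by
  unfold sphereStep tangentPart
  refine Measurable.subtype_mk ?_
  fun_prop

/-- The Gaussian law `N(0, h² I)` on `ℝ^n`. -/
noncomputable def gaussianStep (n : ℕ) (h : ℝ) : Measure (Euc n) :=
  (stdGaussian (Euc n)).map fun ξ => h • ξ

instance (n : ℕ) (h : ℝ) : IsProbabilityMeasure (gaussianStep n h) :=
  Measure.isProbabilityMeasure_map (by fun_prop)

/-- The random walk proposal `Q_S` on `𝕊^d`: `Q_S(z, ·)` is the law of the random walk move from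
`z` driven by `ξ ∼ N(0, h² I)`. -/
noncomputable def QS (d : ℕ) (h : ℝ) : Kernel (Sph d) (Sph d) where
  toFun z := (gaussianStep (d + 1) h).map (sphereStep z)
  measurable' := by
    refine Measure.measurable_of_measurable_coe _ fun s hs => ?_
    simp_rw [Measure.map_apply (measurable_sphereStep_right _) hs]
    exact measurable_measure_prodMk_left (measurable_sphereStep hs)

instance (d : ℕ) (h : ℝ) : IsMarkovKernel (QS d h) :=
  ⟨fun z => Measure.isProbabilityMeasure_map (measurable_sphereStep_right z).aemeasurable⟩

/-- The density `Q_S(z, ẑ)` of `Q_S(z, ·)` with respect to the surface measure, jointly measurable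
in `(z, ẑ)`. -/
noncomputable def qS (d : ℕ) (h : ℝ) (z y : Sph d) : ℝ≥0∞ :=
  Kernel.rnDeriv (QS d h) (Kernel.const (Sph d) (surface d)) z y

theorem measurable_qS (d : ℕ) (h : ℝ) (z : Sph d) : Measurable (qS d h z) :=
  Kernel.measurable_rnDeriv_right _ _ z

end Proposal

section Kernels

variable {α β : Type*} [MeasurableSpace α] [MeasurableSpace β]

/-- `n` independent draws from `κ a`. -/
noncomputable def iidDraws (κ : Kernel α β) [IsMarkovKernel κ] (n : ℕ) :
    Kernel α (Fin n → β) where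
  toFun a := Measure.pi fun _ => κ a
  measurable' := by
    refine Measurable.measure_of_isPiSystem_of_isProbabilityMeasure generateFrom_pi.symm
      isPiSystem_pi ?_
    rintro _ ⟨s, hs, rfl⟩
    simp_rw [Measure.pi_pi]
    exact Finset.measurable_prod _ fun i _ => κ.measurable_coe (hs i (Set.mem_univ i))

instance (κ : Kernel α β) [IsMarkovKernel κ] (n : ℕ) : IsMarkovKernel (iidDraws κ n) :=
  ⟨fun a => inferInstanceAs (IsProbabilityMeasure (Measure.pi fun _ : Fin n => κ a))⟩

/-- The transition kernel whose accepted moves from `x` are distributed according to the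
subprobability `M x`, and which stays at `x` with the remaining probability `1 - M x univ`. -/
noncomputable def withRejection (M : Kernel α α) : Kernel α α where
  toFun x := M x + (1 - M x Set.univ) • Measure.dirac x
  measurable' := by
    refine Measure.measurable_of_measurable_coe _ fun s hs => ?_
    simp only [Measure.coe_add, Pi.add_apply, Measure.smul_apply, smul_eq_mul]
    refine (M.measurable_coe hs).add (Measurable.mul ?_ ?_)
    · exact measurable_const.sub (M.measurable_coe MeasurableSet.univ)
    · exact (Measure.measurable_coe hs).comp Measure.measurable_dirac

theorem isMarkovKernel_withRejection {M : Kernel α α} (hM : ∀ x, M x Set.univ ≤ 1) :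
    IsMarkovKernel (withRejection M) :=
  ⟨fun x => ⟨by
    change (M x + (1 - M x Set.univ) • Measure.dirac x) Set.univ = 1
    simp [add_tsub_cancel_of_le (hM x)]⟩⟩

/-- The law on path space of the Markov chain with initial law `μ` and transition kernel `P`. -/
noncomputable def chainLaw (μ : Measure α) [IsProbabilityMeasure μ]
    (P : Kernel α α) [IsMarkovKernel P] : ProbabilityMeasure (ℕ → α) :=
  ⟨Kernel.trajMeasure (X := fun _ => α) μ fun n =>
      P.comap (fun x : (i : Finset.Iic n) → α => x ⟨n, Finset.mem_Iic.mpr le_rfl⟩)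
        (measurable_pi_apply _),
    inferInstance⟩

end Kernels

section Target

/-- The target distribution on `ℝ^d` with Lebesgue density `π`. -/
noncomputable def targetLaw {d : ℕ} (π : Euc d → ℝ≥0) : Measure (Euc d) :=
  volume.withDensity fun x => (π x : ℝ≥0∞)

/-- The unnormalised transferred density `π(x) (R² + ‖x‖²)^d`, `x = SP(z)`. -/
noncomputable def piSUnnorm {d : ℕ} (R : ℝ) (π : Euc d → ℝ≥0) (z : Sph d) : ℝ≥0∞ :=
  (π (stereo R z) : ℝ≥0∞) * ENNReal.ofReal ((R ^ 2 + ‖stereo R z‖ ^ 2) ^ d)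

/-- The target density `π_S(z) ∝ π(x) (R² + ‖x‖²)^d` with respect to the surface measure. -/
noncomputable def piS {d : ℕ} (R : ℝ) (π : Euc d → ℝ≥0) (z : Sph d) : ℝ≥0∞ :=
  piSUnnorm R π z / ∫⁻ y, piSUnnorm R π y ∂(surface d)

/-- The target distribution on `𝕊^d`, with density `π_S`. -/
noncomputable def sphereTargetLaw {d : ℕ} (R : ℝ) (π : Euc d → ℝ≥0) : Measure (Sph d) :=
  (surface d).withDensity (piS R π)

end Target

section Chains

/-- Probability `ω(z, ẑ_j) / ∑ᵢ ω(z, ẑᵢ)` of selecting the candidate `j`. -/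
noncomputable def selectProb {d N : ℕ} (ω : Sph d → Sph d → ℝ≥0) (z : Sph d)
    (y : Fin N → Sph d) (j : Fin N) : ℝ≥0∞ :=
  (ω z (y j) : ℝ≥0∞) / (∑ i, (ω z (y i) : ℝ≥0∞))

/-- Acceptance probability of the selected candidate `ẑ_j = y j`, given the candidates `y` and the
reverse draws `w` from `Q_S(ẑ_j, ·)`. -/
noncomputable def smtmAccept {d N : ℕ} (R : ℝ) (π : Euc d → ℝ≥0) (ω : Sph d → Sph d → ℝ≥0)
    (z : Sph d) (y : Fin N → Sph d) (j : Fin N) (w : Fin (N - 1) → Sph d) : ℝ≥0∞ :=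
  min 1 ((piS R π (y j) * ω (y j) z / ((∑ i, (ω (y j) (w i) : ℝ≥0∞)) + ω (y j) z)) /
    (piS R π z * ω z (y j) / (∑ i, (ω z (y i) : ℝ≥0∞))))

/-- Accepted moves of SMTM with `N` candidates, on the sphere: draw `N` candidates from
`Q_S(z, ·)`, select the `j`-th one, draw `N - 1` reverse points from `Q_S(ẑ_j, ·)` and accept. -/
noncomputable def smtmMove {d : ℕ} (R h : ℝ) (π : Euc d → ℝ≥0) (ω : Sph d → Sph d → ℝ≥0) (N : ℕ) :
    Kernel (Sph d) (Sph d) :=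
  ∑ j : Fin N,
    (Kernel.withDensity
      (iidDraws (QS d h) N ⊗ₖ
        (iidDraws (QS d h) (N - 1)).comap (fun p : Sph d × (Fin N → Sph d) => p.2 j)
          ((measurable_pi_apply j).comp measurable_snd))
      fun z p => selectProb ω z p.1 j * smtmAccept R π ω z p.1 j p.2).map fun p => p.1 j

/-- The proposal density `Q_∞(z, ẑ) = ω(z, ẑ) Q_S(z, ẑ) / ∫ ω(z, y) Q_S(z, y) dy` of the ideal
scheme with respect to the surface measure. -/
noncomputable def qInf {d : ℕ} (h : ℝ) (ω : Sph d → Sph d → ℝ≥0) (z y : Sph d) : ℝ≥0∞ :=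
  (ω z y * qS d h z y) / ∫⁻ u, ω z u * qS d h z u ∂(surface d)

/-- Metropolis-Hastings acceptance probability of the ideal scheme. -/
noncomputable def idealAccept {d : ℕ} (R h : ℝ) (π : Euc d → ℝ≥0) (ω : Sph d → Sph d → ℝ≥0)
    (z y : Sph d) : ℝ≥0∞ :=
  min 1 ((piS R π y * qInf h ω y z) / (piS R π z * qInf h ω z y))

/-- Accepted moves of the ideal scheme, on the sphere. -/
noncomputable def idealMove {d : ℕ} (R h : ℝ) (π : Euc d → ℝ≥0) (ω : Sph d → Sph d → ℝ≥0) :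
    Kernel (Sph d) (Sph d) :=
  Kernel.withDensity (Kernel.const (Sph d) (surface d))
    fun z y => qInf h ω z y * idealAccept R h π ω z y

/-- The transition kernel on `ℝ^d` that lifts `x` to the sphere, performs the accepted moves `M`
there and projects them back, and otherwise stays at `x`. -/
noncomputable def pullback {d : ℕ} {R : ℝ} (hR : 0 < R) (M : Kernel (Sph d) (Sph d)) :
    Kernel (Euc d) (Euc d) :=
  withRejection ((M.map (stereo R)).comap (stereoInv hR) (measurable_stereoInv hR))

theorem isMarkovKernel_pullback {d : ℕ} {R : ℝ} (hR : 0 < R) {M : Kernel (Sph d) (Sph d)}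
    (hM : ∀ z, M z Set.univ ≤ 1) : IsMarkovKernel (pullback hR M) := by
  refine isMarkovKernel_withRejection fun x => ?_
  rw [Kernel.comap_apply]
  by_cases hs : Measurable (stereo (d := d) R)
  · rw [Kernel.map_apply' _ hs _ MeasurableSet.univ]
    exact hM _
  · rw [Kernel.map_of_not_measurable _ hs]
    simp

theorem withDensity_univ_le {α β : Type*} [MeasurableSpace α] [MeasurableSpace β]
    (κ : Kernel α β) [IsSFiniteKernel κ] (f : α → β → ℝ≥0∞) (a : α) :
    Kernel.withDensity κ f a Set.univ ≤ ∫⁻ b, f a b ∂(κ a) := by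
  by_cases hf : Measurable (Function.uncurry f)
  · rw [Kernel.withDensity_apply' _ hf, setLIntegral_univ]
  · rw [Kernel.withDensity_of_not_measurable _ hf]
    simp

theorem smtmMove_le_one {d : ℕ} (R h : ℝ) (π : Euc d → ℝ≥0) {ω : Sph d → Sph d → ℝ≥0}
    (hω : Measurable (Function.uncurry ω)) (N : ℕ) (z : Sph d) :
    smtmMove R h π ω N z Set.univ ≤ 1 := by
  have hωz : ∀ j : Fin N, Measurable fun y : Fin N → Sph d => (ω z (y j) : ℝ≥0∞) := fun j =>
    (hω.comp (measurable_const.prodMk (measurable_pi_apply j))).coe_nnreal_ennreal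
  have hsel : ∀ j : Fin N, Measurable fun y : Fin N → Sph d => selectProb ω z y j := fun j =>
    (hωz j).div (Finset.measurable_sum _ fun i _ => hωz i)
  calc smtmMove R h π ω N z Set.univ
      ≤ ∑ j : Fin N, ∫⁻ y, selectProb ω z y j ∂(iidDraws (QS d h) N z) := by
        rw [smtmMove, Kernel.finsetSum_apply']
        refine Finset.sum_le_sum fun j _ => ?_
        have hj : Measurable fun p : (Fin N → Sph d) × (Fin (N - 1) → Sph d) => p.1 j :=
          (measurable_pi_apply j).comp measurable_fst
        rw [Kernel.map_apply' _ hj _ MeasurableSet.univ, Set.preimage_univ]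
        refine (withDensity_univ_le _ _ _).trans ?_
        refine (lintegral_mono (g := fun p => selectProb ω z p.1 j) fun p => ?_).trans ?_
        · exact mul_le_of_le_one_right' (min_le_left _ _)
        · have hf : Measurable fun p : (Fin N → Sph d) × (Fin (N - 1) → Sph d) =>
              selectProb ω z p.1 j := (hsel j).comp measurable_fst
          rw [Kernel.lintegral_compProd _ _ _ hf]
          simp
    _ = ∫⁻ y, ∑ j : Fin N, selectProb ω z y j ∂(iidDraws (QS d h) N z) :=
        (lintegral_finsetSum _ fun j _ => hsel j).symm
    _ ≤ ∫⁻ _, 1 ∂(iidDraws (QS d h) N z) := by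
        refine lintegral_mono fun y => ?_
        simp only [selectProb, div_eq_mul_inv]
        rw [← Finset.sum_mul]
        exact ENNReal.mul_inv_le_one _
    _ = 1 := by simp

theorem idealMove_le_one {d : ℕ} (R h : ℝ) (π : Euc d → ℝ≥0) {ω : Sph d → Sph d → ℝ≥0}
    (hω : Measurable (Function.uncurry ω)) (z : Sph d) :
    idealMove R h π ω z Set.univ ≤ 1 := by
  have hm : Measurable fun u => (ω z u : ℝ≥0∞) * qS d h z u :=
    (hω.comp measurable_prodMk_left).coe_nnreal_ennreal.mul (measurable_qS d h z)
  refine (withDensity_univ_le _ _ _).trans ?_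
  rw [Kernel.const_apply]
  refine (lintegral_mono (g := fun u => qInf h ω z u) fun p => ?_).trans ?_
  · exact mul_le_of_le_one_right' (min_le_left _ _)
  · simp only [qInf, div_eq_mul_inv]
    rw [lintegral_mul_const _ hm]
    exact ENNReal.mul_inv_le_one _

/-- Transition kernel on `ℝ^d` of the stereographic multiple-try Metropolis algorithm with sphere
parameter `R`, step size `h`, target density `π`, weight function `ω` and `N` candidates
(`N ≥ 1`; for `N = 0` it never moves). -/
noncomputable def smtmKernel {d : ℕ} {R : ℝ} (hR : 0 < R) (h : ℝ) (π : Euc d → ℝ≥0)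
    {ω : Sph d → Sph d → ℝ≥0} (_hω : Measurable (Function.uncurry ω)) (N : ℕ) :
    Kernel (Euc d) (Euc d) :=
  pullback hR (smtmMove R h π ω N)

instance {d : ℕ} {R : ℝ} (hR : 0 < R) (h : ℝ) (π : Euc d → ℝ≥0)
    {ω : Sph d → Sph d → ℝ≥0} (hω : Measurable (Function.uncurry ω)) (N : ℕ) :
    IsMarkovKernel (smtmKernel hR h π hω N) :=
  isMarkovKernel_pullback hR (smtmMove_le_one R h π hω N)

/-- Transition kernel on `ℝ^d` of the ideal scheme. -/
noncomputable def idealKernel {d : ℕ} {R : ℝ} (hR : 0 < R) (h : ℝ) (π : Euc d → ℝ≥0)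
    {ω : Sph d → Sph d → ℝ≥0} (_hω : Measurable (Function.uncurry ω)) :
    Kernel (Euc d) (Euc d) :=
  pullback hR (idealMove R h π ω)

instance {d : ℕ} {R : ℝ} (hR : 0 < R) (h : ℝ) (π : Euc d → ℝ≥0)
    {ω : Sph d → Sph d → ℝ≥0} (hω : Measurable (Function.uncurry ω)) :
    IsMarkovKernel (idealKernel hR h π hω) :=
  isMarkovKernel_pullback hR (idealMove_le_one R h π hω)

end Chains

end SMTM

/-! Fix a state `z` and couple all numbers of candidates by drawing them from one i.i.d. sequence
`Y` of law `Q_S(z, ·)`. The candidates are exchangeable, so the accepted moves with `N` candidates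
have integral `E[g(Y 0) · N · (probability of selecting Y 0) · (mean acceptance of Y 0)]`. By the
law of large numbers, `N` times the selection probability tends to `ω(z, Y 0) / W(z)`, where `W` is
`meanWeight`, and the sums of weights in the acceptance ratio, once divided by `N`, tend to `W(z)`
and `W(Y 0)`. The integrals converge too, by a Scheffé argument: the dominating factor `N ·
selectProb` has mean at most `1`, which is the mean of its limit (`boundedlyConvergesTo_smtmMove`).

The limiting acceptance ratio contains no proposal density, while the Metropolis-Hastings ratio of
the ideal scheme does. They agree because `Q_S(z, ·)` has a density depending only on the scalar
product with `z` (`QS_eq_withDensity`), so that it is symmetric and cancels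
(`idealMove_eq_withDensity_QS`). The fourth moments enter through `0 < W < ∞` and the positivity of
the weights, almost everywhere.

Weights and target are merely measurable, so weak convergence of the kernels could not be iterated.
`BoundedlyConvergesTo` can: its test functions vary with `N`, so the integral over the last step of
a path is again an admissible test function of the earlier steps
(`boundedlyConvergesTo_chainLaw_prefix`). One-step convergence is known only for almost every
starting point; this suffices because the ideal chain never charges a null set of the target. Open
sets of path space are increasing unions of open cylinders, and the portmanteau theorem concludes
(`tendsto_chainLaw`).

Almost-everywhere statements pass between the sphere and `ℝ^d` through the Jacobian of stereographic
projection (`surface_eq_map_stereoInv`, `targetLaw_map_stereoInv`). -/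

namespace SMTM

/-! ### From one-step convergence to convergence in law of Markov chains. -/

section MarkovChains

open Finset Preorder

variable {E : Type*}

/-- The path up to time `m + 1` made of a path up to time `m` and the next state. -/
def snocPath (m : ℕ) (p : ((i : Iic m) → E) × E) : (i : Iic (m + 1)) → E :=
  fun i => if h : (i : ℕ) ≤ m then p.1 ⟨i, mem_Iic.2 h⟩ else p.2

theorem frestrictLe_succ_eq_snocPath (m : ℕ) (x : ℕ → E) :
    (frestrictLe (π := fun _ => E) (m + 1)) x = snocPath m ((frestrictLe m) x, x (m + 1)) := by
  funext i
  unfold snocPath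
  split_ifs with h
  · rfl
  · have := mem_Iic.1 i.2
    have h2 : (i : ℕ) = m + 1 := by omega
    simp [frestrictLe, h2]

/-- A basic open set of the product constrains finitely many coordinates, hence only a prefix. `V m`
is the largest open set of prefixes whose cylinder lies in `G`; it is monotone because a longer
prefix determines the shorter ones. -/
theorem isOpen_eq_iUnion_preimage_frestrictLe [TopologicalSpace E] {G : Set (ℕ → E)}
    (hG : IsOpen G) : ∃ V : (m : ℕ) → Set ((i : Iic m) → E), (∀ m, IsOpen (V m)) ∧
      Monotone (fun m => frestrictLe (π := fun _ => E) m ⁻¹' V m) ∧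
      G = ⋃ m, frestrictLe (π := fun _ => E) m ⁻¹' V m := by
  refine ⟨fun m => ⋃₀ {U | IsOpen U ∧ frestrictLe (π := fun _ => E) m ⁻¹' U ⊆ G},
    fun m => isOpen_sUnion fun U hU => hU.1, monotone_nat_of_le_succ fun m x hx => ?_, ?_⟩
  · obtain ⟨U, ⟨hU, hUG⟩, hxU⟩ := hx
    refine ⟨frestrictLe₂ (π := fun _ => E) (Nat.le_succ m) ⁻¹' U, ⟨hU.preimage ?_, fun y hy => ?_⟩,
      hxU⟩
    · exact continuous_pi fun i => continuous_apply _
    · exact hUG hy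
  · ext x
    simp only [Set.mem_iUnion]
    constructor
    · intro hx
      obtain ⟨I, u, hu, huG⟩ := isOpen_pi_iff.1 hG x hx
      refine ⟨I.sup id, ⋂ i : I, {y | y ⟨i, mem_Iic.2 (Finset.le_sup (f := id) i.2)⟩ ∈ u i}, ⟨?_, ?_⟩, ?_⟩
      · exact isOpen_iInter_of_finite fun i => (hu i i.2).1.preimage (continuous_apply _)
      · intro y hy
        refine huG fun i hi => ?_
        exact Set.mem_iInter.1 hy ⟨i, hi⟩
      · exact Set.mem_iInter.2 fun i => (hu i i.2).2
    · rintro ⟨m, U, ⟨-, hUG⟩, hxU⟩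
      exact hUG hxU

variable [MeasurableSpace E]

/-- The expectations under `κ N` of uniformly bounded functions that converge almost everywhere
for `ν` converge to the expectation under `ν` of the limit. -/
def BoundedlyConvergesTo (κ : ℕ → Measure E) (ν : Measure E) : Prop :=
  ∀ (g : ℕ → E → ℝ≥0∞) (g' : E → ℝ≥0∞), (∀ n, Measurable (g n)) → Measurable g' →
    (∀ n x, g n x ≤ 1) → (∀ᵐ x ∂ν, Tendsto (fun n => g n x) atTop (𝓝 (g' x))) →
    Tendsto (fun n => ∫⁻ x, g n x ∂(κ n)) atTop (𝓝 (∫⁻ x, g' x ∂ν))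

theorem measurable_snocPath (m : ℕ) : Measurable (snocPath (E := E) m) := by
  refine measurable_pi_lambda _ fun i => ?_
  unfold snocPath
  by_cases h : (i : ℕ) ≤ m
  · simp only [h, dite_true]; fun_prop
  · simp only [h, dite_false]; fun_prop

variable (μ : Measure E) [IsProbabilityMeasure μ] (P : Kernel E E) [IsMarkovKernel P]

theorem chainLaw_map_frestrictLe_zero :
    (chainLaw μ P : Measure (ℕ → E)).map (frestrictLe (π := fun _ => E) 0)
      = μ.map (MeasurableEquiv.piUnique (fun _ : Iic 0 => E)).symm := by
  change (Kernel.trajMeasure (X := fun _ => E) μ _).map _ = _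
  rw [Kernel.trajMeasure, Measure.map_comp _ _ (by fun_prop), Kernel.traj_map_frestrictLe,
    Kernel.partialTraj_self, Measure.id_comp]

theorem chainLaw_compProd (m : ℕ) :
    ((chainLaw μ P : Measure (ℕ → E)).map (frestrictLe (π := fun _ => E) m)) ⊗ₘ
        P.comap (fun x : (i : Iic m) → E => x ⟨m, mem_Iic.mpr le_rfl⟩) (measurable_pi_apply _)
      = (chainLaw μ P : Measure (ℕ → E)).map
          (fun x => (frestrictLe (π := fun _ => E) m x, x (m + 1))) :=
  Kernel.map_frestrictLe_trajMeasure_compProd_eq_map_trajMeasure (X := fun _ => E)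

theorem lintegral_chainLaw_succ (m : ℕ) {g : ((i : Iic m) → E) × E → ℝ≥0∞} (hg : Measurable g) :
    ∫⁻ x, g (frestrictLe (π := fun _ => E) m x, x (m + 1)) ∂(chainLaw μ P : Measure (ℕ → E))
      = ∫⁻ x, ∫⁻ y, g (x, y) ∂(P (x ⟨m, mem_Iic.mpr le_rfl⟩))
        ∂((chainLaw μ P : Measure (ℕ → E)).map (frestrictLe (π := fun _ => E) m)) := by
  have h := chainLaw_compProd μ P m
  rw [← lintegral_map hg (by fun_prop), ← h, Measure.lintegral_compProd hg]
  rfl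

variable {μ P}

/-- Lets a property of `μ`-almost every state be used at every time of the chain. Invariance of `μ`
would give more than is needed here. -/
theorem chainLaw_map_eval_absolutelyContinuous
    (hnull : ∀ B, MeasurableSet B → μ B = 0 → ∀ᵐ x ∂μ, P x B = 0) (m : ℕ) :
    (chainLaw μ P : Measure (ℕ → E)).map (fun x => x m) ≪ μ := by
  induction m with
  | zero =>
    have h := chainLaw_map_frestrictLe_zero μ P
    have h2 : (fun x : ℕ → E => x 0)
        = (fun y : (i : Iic 0) → E => y ⟨0, mem_Iic.mpr le_rfl⟩) ∘ frestrictLe (π := fun _ => E) 0 :=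
      rfl
    rw [h2, ← Measure.map_map (by fun_prop) (by fun_prop), h, Measure.map_map (by fun_prop)
      (MeasurableEquiv.measurable _)]
    have h3 : ((fun y : (i : Iic 0) → E => y ⟨0, mem_Iic.mpr le_rfl⟩) ∘
      (MeasurableEquiv.piUnique (fun _ : Iic 0 => E)).symm) = id := by
      funext x
      exact (MeasurableEquiv.piUnique (fun _ : Iic 0 => E)).apply_symm_apply x
    rw [h3, Measure.map_id]
  | succ m ih =>
    refine Measure.AbsolutelyContinuous.mk fun B hB hB0 => ?_
    rw [Measure.map_apply (measurable_pi_apply _) hB, ← lintegral_indicator_one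
      (measurable_pi_apply _ hB)]
    have h := lintegral_chainLaw_succ μ P m (g := fun p => B.indicator 1 p.2)
      ((measurable_one.indicator hB).comp measurable_snd)
    have h2 : ∀ x : ℕ → E, ((fun x => x (m + 1)) ⁻¹' B).indicator (1 : (ℕ → E) → ℝ≥0∞) x
        = B.indicator 1 (x (m + 1)) := fun x => rfl
    simp only [h2]
    rw [h]
    simp only [lintegral_indicator_one hB]
    have hm : Measurable fun x : (i : Iic m) → E => P (x ⟨m, mem_Iic.mpr le_rfl⟩) B :=
      (P.measurable_coe hB).comp (measurable_pi_apply _)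
    rw [lintegral_map hm (by fun_prop)]
    have h4 := ih.ae_le (hnull B hB hB0)
    have h5 := ae_of_ae_map (measurable_pi_apply _).aemeasurable h4
    exact (lintegral_congr_ae h5).trans lintegral_zero

/-- Induction on the length of the prefix: integrating out the last state turns `g n` into a
function of the shorter prefix which is still bounded by `1` and converges at almost every prefix,
by one-step convergence at its endpoint. -/
theorem boundedlyConvergesTo_chainLaw_prefix {Q : ℕ → Kernel E E} [∀ n, IsMarkovKernel (Q n)]
    (hnull : ∀ B, MeasurableSet B → μ B = 0 → ∀ᵐ x ∂μ, P x B = 0)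
    (hconv : ∀ᵐ x ∂μ, BoundedlyConvergesTo (fun n => Q n x) (P x)) (m : ℕ) :
    BoundedlyConvergesTo
      (fun n => (chainLaw μ (Q n) : Measure (ℕ → E)).map (frestrictLe (π := fun _ => E) m))
      ((chainLaw μ P : Measure (ℕ → E)).map (frestrictLe (π := fun _ => E) m)) := by
  induction m with
  | zero =>
    intro g g' hg hg' hle hlim
    simp only [chainLaw_map_frestrictLe_zero] at hlim ⊢
    have : IsProbabilityMeasure (μ.map (MeasurableEquiv.piUnique (fun _ : Iic 0 => E)).symm) :=
      Measure.isProbabilityMeasure_map (MeasurableEquiv.measurable _).aemeasurable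
    exact tendsto_lintegral_of_dominated_convergence (fun _ => 1) hg
      (fun n => ae_of_all _ (hle n)) (by simp) hlim
  | succ m ih =>
    intro g g' hg hg' hle hlim
    have hs := measurable_snocPath (E := E) m
    have key : ∀ (S : Kernel E E) [IsMarkovKernel S] (f : ((i : Iic (m + 1)) → E) → ℝ≥0∞),
        Measurable f → ∫⁻ x, f x ∂((chainLaw μ S : Measure (ℕ → E)).map
          (frestrictLe (π := fun _ => E) (m + 1)))
        = ∫⁻ x, ∫⁻ y, f (snocPath m (x, y)) ∂(S (x ⟨m, mem_Iic.mpr le_rfl⟩))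
        ∂((chainLaw μ S : Measure (ℕ → E)).map (frestrictLe (π := fun _ => E) m)) := by
      intro S _ f hf
      rw [lintegral_map hf (by fun_prop)]
      simp only [frestrictLe_succ_eq_snocPath]
      exact lintegral_chainLaw_succ μ S m (hf.comp hs)
    have hmeas : ∀ (S : Kernel E E) [IsMarkovKernel S] (f : ((i : Iic (m + 1)) → E) → ℝ≥0∞),
        Measurable f → Measurable fun x : (i : Iic m) → E =>
          ∫⁻ y, f (snocPath m (x, y)) ∂(S (x ⟨m, mem_Iic.mpr le_rfl⟩)) := by
      intro S _ f hf
      exact Measurable.lintegral_kernel_prod_right'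
        (κ := S.comap (fun x : (i : Iic m) → E => x ⟨m, mem_Iic.mpr le_rfl⟩)
          (measurable_pi_apply _)) (hf.comp hs)
    rw [key P g' hg']
    simp only [key (Q _) _ (hg _)]
    refine ih _ _ (fun n => hmeas _ _ (hg n)) (hmeas _ _ hg') (fun n x => ?_) ?_
    · calc _ ≤ ∫⁻ y, 1 ∂(Q n (x ⟨m, mem_Iic.mpr le_rfl⟩)) := lintegral_mono fun y => hle n _
        _ = 1 := by simp
    · have hac := chainLaw_map_eval_absolutelyContinuous (P := P) hnull m
      have h1 : ∀ᵐ x ∂((chainLaw μ P : Measure (ℕ → E)).map (frestrictLe (π := fun _ => E) m)),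
          BoundedlyConvergesTo (fun n => Q n (x ⟨m, mem_Iic.mpr le_rfl⟩))
            (P (x ⟨m, mem_Iic.mpr le_rfl⟩)) := by
        have h2 : (chainLaw μ P : Measure (ℕ → E)).map (fun x => x m)
            = ((chainLaw μ P : Measure (ℕ → E)).map (frestrictLe (π := fun _ => E) m)).map
              (fun x => x ⟨m, mem_Iic.mpr le_rfl⟩) := by
          rw [Measure.map_map (by fun_prop) (by fun_prop)]
          rfl
        rw [h2] at hac
        exact ae_of_ae_map (measurable_pi_apply _).aemeasurable (hac.ae_le hconv)
      -- Disintegration of the almost sure convergence of `g n` along the last step.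
      have h3 : ∀ᵐ x ∂((chainLaw μ P : Measure (ℕ → E)).map (frestrictLe (π := fun _ => E) m)),
          ∀ᵐ y ∂(P (x ⟨m, mem_Iic.mpr le_rfl⟩)),
            Tendsto (fun n => g n (snocPath m (x, y))) atTop (𝓝 (g' (snocPath m (x, y)))) := by
        refine Measure.ae_ae_of_ae_compProd (κ := P.comap
          (fun x : (i : Iic m) → E => x ⟨m, mem_Iic.mpr le_rfl⟩) (measurable_pi_apply _))
          (p := fun p => Tendsto (fun n => g n (snocPath m p)) atTop (𝓝 (g' (snocPath m p)))) ?_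
        rw [chainLaw_compProd]
        have hset : MeasurableSet {x | Tendsto (fun n => g n x) atTop (𝓝 (g' x))} :=
          measurableSet_tendsto_fun hg hg'
        refine (ae_map_iff (Measurable.aemeasurable (by fun_prop)) (hs hset)).2 ?_
        rw [ae_map_iff (by fun_prop) hset] at hlim
        filter_upwards [hlim] with x hx
        simpa only [frestrictLe_succ_eq_snocPath] using hx
      filter_upwards [h1, h3] with x hx hy
      exact hx _ _ (fun n => ((hg n).comp hs).comp measurable_prodMk_left)
        ((hg'.comp hs).comp measurable_prodMk_left) (fun n y => hle n _) hy

/-- Weak convergence of Markov chains started from the same law whose kernels converge boundedly at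
almost every starting point. -/
theorem tendsto_chainLaw [TopologicalSpace E] [PolishSpace E] [BorelSpace E]
    {Q : ℕ → Kernel E E} [∀ n, IsMarkovKernel (Q n)]
    (hnull : ∀ B, MeasurableSet B → μ B = 0 → ∀ᵐ x ∂μ, P x B = 0)
    (hconv : ∀ᵐ x ∂μ, BoundedlyConvergesTo (fun n => Q n x) (P x)) :
    Tendsto (fun n => chainLaw μ (Q n)) atTop (𝓝 (chainLaw μ P)) := by
  refine tendsto_of_forall_isOpen_le_liminf' fun G hG => ?_
  obtain ⟨V, hV, hmono, rfl⟩ := isOpen_eq_iUnion_preimage_frestrictLe hG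
  -- Continuity from below reduces the bound for `G` to each of its open cylinders, whose
  -- probabilities converge.
  refine le_of_tendsto' (tendsto_measure_iUnion_atTop hmono) fun m => ?_
  have hVm : MeasurableSet (V m) := (hV m).measurableSet
  have h := boundedlyConvergesTo_chainLaw_prefix hnull hconv m (fun _ => (V m).indicator 1)
    ((V m).indicator 1) (fun _ => measurable_one.indicator hVm) (measurable_one.indicator hVm)
    (fun _ => Set.indicator_le_self' (by simp)) (by simp)
  simp only [lintegral_indicator_one hVm] at h
  simp only [Measure.map_apply (show Measurable (frestrictLe (π := fun _ => E) m) by fun_prop) hVm]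
    at h
  refine h.liminf_eq.symm.le.trans ?_
  exact liminf_le_liminf (Eventually.of_forall fun n =>
    measure_mono (Set.subset_iUnion (fun m => frestrictLe (π := fun _ => E) m ⁻¹' V m) m))

end MarkovChains

end SMTM

namespace SMTM

/-! ### Scheffé-type dominated convergence and the law of large numbers. -/

section Limits

variable {α : Type*} [MeasurableSpace α]

/-- Dominated convergence with varying dominating functions `G n` whose integrals do not exceed
that of their limit. -/
theorem tendsto_lintegral_of_le_of_lintegral_le {ν : Measure α} {f G : ℕ → α → ℝ≥0∞}
    {f' G' : α → ℝ≥0∞} (hf : ∀ n, Measurable (f n)) (hG : ∀ n, Measurable (G n))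
    (hG' : Measurable G') (hle : ∀ n, ∀ᵐ x ∂ν, f n x ≤ G n x)
    (hflim : ∀ᵐ x ∂ν, Tendsto (fun n => f n x) atTop (𝓝 (f' x)))
    (hGlim : ∀ᵐ x ∂ν, Tendsto (fun n => G n x) atTop (𝓝 (G' x)))
    (hfin : ∫⁻ x, G' x ∂ν ≠ ∞) (hint : ∀ n, ∫⁻ x, G n x ∂ν ≤ ∫⁻ x, G' x ∂ν) :
    Tendsto (fun n => ∫⁻ x, f n x ∂ν) atTop (𝓝 (∫⁻ x, f' x ∂ν)) := by
  have hminG : Tendsto (fun n => ∫⁻ x, min (G n x) (G' x) ∂ν) atTop (𝓝 (∫⁻ x, G' x ∂ν)) := by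
    refine tendsto_lintegral_of_dominated_convergence G' (fun n => (hG n).min hG')
      (fun n => ae_of_all _ fun x => min_le_right _ _) hfin ?_
    filter_upwards [hGlim] with x hx
    simpa using hx.min (tendsto_const_nhds (x := G' x))
  -- Truncated subtraction gives `min (G n) G' + (G n - G') = G n`, whose integral is at most that
  -- of `G'`; so the excess of `G n` over `G'` is controlled by the deficit of the minimum, which
  -- vanishes.
  have hexc : Tendsto (fun n => ∫⁻ x, (G n x - G' x) ∂ν) atTop (𝓝 0) := by
    have h1 : ∀ n, ∫⁻ x, (G n x - G' x) ∂ν ≤ ∫⁻ x, G' x ∂ν - ∫⁻ x, min (G n x) (G' x) ∂ν := by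
      intro n
      have h2 : ∫⁻ x, min (G n x) (G' x) ∂ν ≠ ∞ :=
        ((lintegral_mono fun x => min_le_right _ _).trans_lt hfin.lt_top).ne
      refine ENNReal.le_sub_of_add_le_left h2 ?_
      rw [← lintegral_add_left ((hG n).min hG')]
      refine le_trans (lintegral_mono fun x => ?_) (hint n)
      rcases le_total (G n x) (G' x) with h | h
      · simp [h, tsub_eq_zero_of_le h]
      · simp [h, add_tsub_cancel_of_le]
    refine tendsto_of_tendsto_of_tendsto_of_le_of_le tendsto_const_nhds ?_ (fun n => zero_le)
      h1
    have h3 := ENNReal.Tendsto.sub (tendsto_const_nhds (x := ∫⁻ x, G' x ∂ν)) hminG (Or.inl hfin)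
    simpa using h3
  have hminf : Tendsto (fun n => ∫⁻ x, min (f n x) (G' x) ∂ν) atTop (𝓝 (∫⁻ x, f' x ∂ν)) := by
    refine tendsto_lintegral_of_dominated_convergence G' (fun n => (hf n).min hG')
      (fun n => ae_of_all _ fun x => min_le_right _ _) hfin ?_
    filter_upwards [hflim, hGlim, ae_all_iff.2 hle] with x hx hx' hl
    have h4 : f' x ≤ G' x := le_of_tendsto_of_tendsto' hx hx' hl
    simpa [h4] using hx.min (tendsto_const_nhds (x := G' x))
  -- Squeeze: `min (f n) G' ≤ f n ≤ min (f n) G' + (G n - G')`.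
  refine tendsto_of_tendsto_of_tendsto_of_le_of_le hminf
    (by simpa using hminf.add hexc) (fun n => lintegral_mono fun x => min_le_left _ _) fun n => ?_
  simp only
  rw [← lintegral_add_left ((hf n).min hG')]
  refine lintegral_mono_ae ?_
  filter_upwards [hle n] with x hx
  rcases le_total (f n x) (G' x) with h | h
  · simp [h]
  · rw [min_eq_right h]
    exact hx.trans le_add_tsub

/-- The strong law of large numbers for nonnegative functions of independent draws. -/
theorem ae_tendsto_average {ν : Measure α} [IsProbabilityMeasure ν] {f : α → ℝ≥0}
    (hf : Measurable f) (hfin : ∫⁻ x, f x ∂ν ≠ ∞) :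
    ∀ᵐ Y ∂(Measure.infinitePi fun _ : ℕ => ν),
      Tendsto (fun n : ℕ => (∑ i : Fin n, (f (Y i) : ℝ≥0∞)) / n) atTop (𝓝 (∫⁻ x, f x ∂ν)) := by
  have hfr : Measurable fun x => (f x : ℝ) := hf.coe_nnreal_real
  have hint : Integrable (fun x => (f x : ℝ)) ν := by
    refine ⟨hfr.aestronglyMeasurable, ?_⟩
    rw [hasFiniteIntegral_iff_ofNNReal]
    exact hfin.lt_top
  have hev := fun i => measurePreserving_eval_infinitePi (fun _ : ℕ => ν) i
  have h := strong_law_ae_real (μ := Measure.infinitePi fun _ : ℕ => ν)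
    (fun i Y => (f (Y i) : ℝ)) ((hev 0).integrable_comp_of_integrable hint)
    (fun i j hij => (iIndepFun_infinitePi (P := fun _ : ℕ => ν) (X := fun _ x => (f x : ℝ))
      (fun _ => hfr)).indepFun hij)
    (fun i => ⟨(hfr.comp (measurable_pi_apply i)).aemeasurable,
      (hfr.comp (measurable_pi_apply 0)).aemeasurable, by
        have h1 := (hev i).map_eq
        have h2 := (hev 0).map_eq
        change Measure.map ((fun x => (f x : ℝ)) ∘ (Function.eval i : (ℕ → α) → α)) _
          = Measure.map ((fun x => (f x : ℝ)) ∘ (Function.eval 0 : (ℕ → α) → α)) _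
        rw [← Measure.map_map hfr (measurable_pi_apply i), h1,
          ← Measure.map_map hfr (measurable_pi_apply 0), h2]⟩)
  have hI : ∫⁻ x, (f x : ℝ≥0∞) ∂ν
      = ENNReal.ofReal (∫ Y, (f (Y 0) : ℝ) ∂(Measure.infinitePi fun _ : ℕ => ν)) := by
    have h1 : ∫ Y, (f (Y 0) : ℝ) ∂(Measure.infinitePi fun _ : ℕ => ν) = ∫ x, (f x : ℝ) ∂ν := by
      rw [← (hev 0).map_eq, integral_map (measurable_pi_apply 0).aemeasurable
        hfr.aestronglyMeasurable]
      simp [(hev 0).map_eq]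
    rw [h1, ofReal_integral_eq_lintegral_ofReal hint (ae_of_all _ fun x => by simp)]
    simp
  filter_upwards [h] with Y hY
  rw [hI]
  refine Tendsto.congr' ?_ (ENNReal.tendsto_ofReal hY)
  filter_upwards [eventually_gt_atTop 0] with n hn
  rw [ENNReal.ofReal_div_of_pos (by exact_mod_cast hn), ENNReal.ofReal_natCast,
    ENNReal.ofReal_sum_of_nonneg (fun _ _ => by simp), Finset.sum_range]
  simp

/-- Truncating an infinite sequence of independent draws. -/
theorem measurePreserving_infinitePi_fin (ν : Measure α) [IsProbabilityMeasure ν] (n : ℕ) :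
    MeasurePreserving (fun (Y : ℕ → α) (i : Fin n) => Y i) (Measure.infinitePi fun _ : ℕ => ν)
      (Measure.pi fun _ : Fin n => ν) := by
  refine ⟨by fun_prop, ?_⟩
  rw [← Measure.infinitePi_eq_pi]
  exact Measure.map_infinitePi_infinitePi_of_inj (P := fun _ : ℕ => ν) Fin.val_injective

end Limits

/-! ### Measurability of the densities and probabilities that define the chains. -/

section Measurability

theorem measurable_stereo {d : ℕ} (R : ℝ) : Measurable (stereo (d := d) R) := by
  unfold stereo
  fun_prop

theorem measurable_piSUnnorm {d : ℕ} (R : ℝ) {π : Euc d → ℝ≥0} (hπ : Measurable π) :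
    Measurable (piSUnnorm R π) := by
  have h := measurable_stereo (d := d) R
  unfold piSUnnorm
  fun_prop

theorem measurable_piS {d : ℕ} (R : ℝ) {π : Euc d → ℝ≥0} (hπ : Measurable π) :
    Measurable (piS R π) :=
  (measurable_piSUnnorm R hπ).div_const _

variable {d : ℕ} {ω : Sph d → Sph d → ℝ≥0}

theorem measurable_selectProb (hω : Measurable (Function.uncurry ω)) {N : ℕ} (j : Fin N) :
    Measurable fun p : Sph d × (Fin N → Sph d) => selectProb ω p.1 p.2 j := by
  unfold selectProb
  have h : ∀ i : Fin N, Measurable fun p : Sph d × (Fin N → Sph d) => (ω p.1 (p.2 i) : ℝ≥0∞) :=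
    fun i => (hω.comp (measurable_fst.prodMk (by fun_prop))).coe_nnreal_ennreal
  exact (h j).div (Finset.measurable_sum _ fun i _ => h i)

theorem measurable_smtmAccept (hω : Measurable (Function.uncurry ω)) (R : ℝ) {π : Euc d → ℝ≥0}
    (hπ : Measurable π) {N : ℕ} (j : Fin N) :
    Measurable fun p : Sph d × (Fin N → Sph d) × (Fin (N - 1) → Sph d) =>
      smtmAccept R π ω p.1 p.2.1 j p.2.2 := by
  have hp := measurable_piS R hπ
  have h : ∀ {f g : Sph d × (Fin N → Sph d) × (Fin (N - 1) → Sph d) → Sph d}, Measurable f →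
      Measurable g → Measurable fun p => (ω (f p) (g p) : ℝ≥0∞) :=
    fun hf hg => (hω.comp (hf.prodMk hg)).coe_nnreal_ennreal
  have hj : Measurable fun p : Sph d × (Fin N → Sph d) × (Fin (N - 1) → Sph d) => p.2.1 j := by
    fun_prop
  unfold smtmAccept
  refine measurable_const.min (((((hp.comp hj).mul (h hj measurable_fst)).div
    ((Finset.measurable_sum _ fun i _ => h hj ?_).add (h hj measurable_fst)))).div
    (((hp.comp measurable_fst).mul (h measurable_fst hj)).div
      (Finset.measurable_sum _ fun i _ => h measurable_fst ?_))) <;> fun_prop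

theorem measurable_qS_uncurry (d : ℕ) (h : ℝ) : Measurable (Function.uncurry (qS d h)) :=
  Kernel.measurable_rnDeriv _ _

end Measurability

end SMTM

namespace SMTM

/-! ### One SMTM step as the number of candidates grows. -/

section ManyCandidates

/-- The mean weight `∫ ω(z, y) Q_S(z, dy)`. -/
noncomputable def meanWeight {d : ℕ} (h : ℝ) (ω : Sph d → Sph d → ℝ≥0) (z : Sph d) : ℝ≥0∞ :=
  ∫⁻ y, ω z y ∂(QS d h z)

/-- The acceptance probability of SMTM when sums of weights are replaced by mean weights. -/
noncomputable def limitAccept {d : ℕ} (R h : ℝ) (π : Euc d → ℝ≥0) (ω : Sph d → Sph d → ℝ≥0)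
    (z y : Sph d) : ℝ≥0∞ :=
  min 1 ((piS R π y * ω y z / meanWeight h ω y) / (piS R π z * ω z y / meanWeight h ω z))

/-- The density, with respect to `Q_S(z, ·)`, of the accepted moves when sums of weights are
replaced by mean weights. -/
noncomputable def limitDensity {d : ℕ} (R h : ℝ) (π : Euc d → ℝ≥0) (ω : Sph d → Sph d → ℝ≥0)
    (z y : Sph d) : ℝ≥0∞ :=
  ω z y / meanWeight h ω z * limitAccept R h π ω z y

/-- The probability of accepting candidate `j`, averaged over the reverse draws. -/
noncomputable def meanAccept {d N : ℕ} (R h : ℝ) (π : Euc d → ℝ≥0) (ω : Sph d → Sph d → ℝ≥0)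
    (z : Sph d) (y : Fin N → Sph d) (j : Fin N) : ℝ≥0∞ :=
  ∫⁻ w, smtmAccept R π ω z y j w ∂(iidDraws (QS d h) (N - 1) (y j))

variable {d : ℕ} {R h : ℝ} {π : Euc d → ℝ≥0} {ω : Sph d → Sph d → ℝ≥0}

theorem measurable_weight (hω : Measurable (Function.uncurry ω)) {α : Type*} [MeasurableSpace α]
    {f g : α → Sph d} (hf : Measurable f) (hg : Measurable g) :
    Measurable fun x => (ω (f x) (g x) : ℝ≥0∞) :=
  (hω.comp (hf.prodMk hg)).coe_nnreal_ennreal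

theorem measurable_meanWeight (h : ℝ) (hω : Measurable (Function.uncurry ω)) :
    Measurable (meanWeight h ω) :=
  Measurable.lintegral_kernel_prod_right' (κ := QS d h)
    (measurable_weight hω measurable_fst measurable_snd)

theorem measurable_selectProb_comp (hω : Measurable (Function.uncurry ω)) {α : Type*}
    [MeasurableSpace α] {N : ℕ} {z : α → Sph d} {y : α → Fin N → Sph d} (hz : Measurable z)
    (hy : Measurable y) (j : Fin N) : Measurable fun a => selectProb ω (z a) (y a) j := by
  simpa only [Function.comp_def] using (measurable_selectProb hω j).comp (hz.prodMk hy)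

theorem measurable_smtmAccept_comp (R : ℝ) (hπ : Measurable π) (hω : Measurable (Function.uncurry ω))
    {α : Type*} [MeasurableSpace α] {N : ℕ} {z : α → Sph d} {y : α → Fin N → Sph d}
    {w : α → Fin (N - 1) → Sph d} (hz : Measurable z) (hy : Measurable y) (hw : Measurable w)
    (j : Fin N) : Measurable fun a => smtmAccept R π ω (z a) (y a) j (w a) := by
  simpa only [Function.comp_def] using
    (measurable_smtmAccept hω R hπ j).comp (hz.prodMk (hy.prodMk hw))

theorem measurable_limitDensity (R h : ℝ) (hπ : Measurable π) (hω : Measurable (Function.uncurry ω))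
    (z : Sph d) : Measurable (limitDensity R h π ω z) := by
  have hp := measurable_piS R hπ
  have hW := measurable_meanWeight h hω
  have h1 := measurable_weight hω (measurable_const (a := z)) measurable_id
  have h2 := measurable_weight hω measurable_id (measurable_const (a := z))
  unfold limitDensity limitAccept
  exact (h1.div_const _).mul (measurable_const.min (((hp.mul h2).div hW).div
    ((measurable_const.mul h1).div_const _)))

theorem smtmAccept_le_one {N : ℕ} (z : Sph d) (y : Fin N → Sph d) (j : Fin N)
    (w : Fin (N - 1) → Sph d) : smtmAccept R π ω z y j w ≤ 1 := min_le_left _ _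

theorem meanAccept_le_one {N : ℕ} (z : Sph d) (y : Fin N → Sph d) (j : Fin N) :
    meanAccept R h π ω z y j ≤ 1 := by
  refine (lintegral_mono fun w => smtmAccept_le_one z y j w).trans ?_
  simp

theorem measurable_meanAccept_comp (R h : ℝ) (hπ : Measurable π) (hω : Measurable (Function.uncurry ω))
    {α : Type*} [MeasurableSpace α] {N : ℕ} (z : Sph d) {y : α → Fin N → Sph d} (hy : Measurable y)
    (j : Fin N) : Measurable fun a => meanAccept R h π ω z (y a) j := by
  have hj : Measurable fun a => y a j := (measurable_pi_apply j).comp hy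
  have hF := measurable_smtmAccept_comp R hπ hω (α := α × (Fin (N - 1) → Sph d))
    (measurable_const (a := z)) (hy.comp measurable_fst) measurable_snd j
  exact Measurable.lintegral_kernel_prod_right'
    (κ := (iidDraws (QS d h) (N - 1)).comap (fun a => y a j) hj) hF

/-- The reverse draws influence only the acceptance, so they can be integrated out first. -/
theorem lintegral_smtmMove (hπ : Measurable π) (hω : Measurable (Function.uncurry ω)) (N : ℕ)
    (z : Sph d) {g : Sph d → ℝ≥0∞} (hg : Measurable g) :
    ∫⁻ y, g y ∂(smtmMove R h π ω N z)
      = ∑ j : Fin N, ∫⁻ y, g (y j) * (selectProb ω z y j * meanAccept R h π ω z y j)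
          ∂(Measure.pi fun _ : Fin N => QS d h z) := by
  rw [smtmMove, _root_.sum_apply, lintegral_finsetSum_measure]
  refine Finset.sum_congr rfl fun j _ => ?_
  have hj : Measurable fun p : (Fin N → Sph d) × (Fin (N - 1) → Sph d) => p.1 j := by fun_prop
  have hs : Measurable fun p : (Fin N → Sph d) × (Fin (N - 1) → Sph d) =>
      selectProb ω z p.1 j :=
    measurable_selectProb_comp hω measurable_const measurable_fst j
  have ha : Measurable fun p : (Fin N → Sph d) × (Fin (N - 1) → Sph d) =>
      smtmAccept R π ω z p.1 j p.2 :=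
    measurable_smtmAccept_comp R hπ hω measurable_const measurable_fst measurable_snd j
  have hF : Measurable (Function.uncurry fun (z : Sph d)
      (p : (Fin N → Sph d) × (Fin (N - 1) → Sph d)) =>
      selectProb ω z p.1 j * smtmAccept R π ω z p.1 j p.2) :=
    (measurable_selectProb_comp hω measurable_fst (measurable_fst.comp measurable_snd) j).mul
      (measurable_smtmAccept hω R hπ j)
  have hsa : Measurable fun p : (Fin N → Sph d) × (Fin (N - 1) → Sph d) =>
      selectProb ω z p.1 j * smtmAccept R π ω z p.1 j p.2 := hs.mul ha
  have hgj : Measurable fun p : (Fin N → Sph d) × (Fin (N - 1) → Sph d) => g (p.1 j) := hg.comp hj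
  rw [Kernel.lintegral_map _ hj _ hg, Kernel.withDensity_apply _ hF,
    lintegral_withDensity_eq_lintegral_mul _ hsa hgj]
  refine (Kernel.lintegral_compProd _ _ _ (hsa.mul hgj)).trans ?_
  simp only [Pi.mul_apply]
  refine lintegral_congr fun y => ?_
  have hay : Measurable fun w : Fin (N - 1) → Sph d => smtmAccept R π ω z y j w :=
    measurable_smtmAccept_comp R hπ hω measurable_const measurable_const measurable_id j
  rw [lintegral_mul_const _ (hay.const_mul _), lintegral_const_mul _ hay, mul_comm]
  rfl

/-- Exchangeable summands have equal integrals under a product of identical laws. -/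
theorem sum_lintegral_pi_eq_of_swap {α : Type*} [MeasurableSpace α] (ν : Measure α)
    [IsProbabilityMeasure ν] {n : ℕ} (F : (Fin (n + 1) → α) → Fin (n + 1) → ℝ≥0∞)
    (hF : Measurable fun y => F y 0) (hswap : ∀ y j, F (fun i => y (Equiv.swap 0 j i)) 0 = F y j) :
    ∑ j, ∫⁻ y, F y j ∂(Measure.pi fun _ : Fin (n + 1) => ν)
      = ((n + 1 : ℕ) : ℝ≥0∞) * ∫⁻ y, F y 0 ∂(Measure.pi fun _ : Fin (n + 1) => ν) := by
  have h : ∀ j, ∫⁻ y, F y j ∂(Measure.pi fun _ : Fin (n + 1) => ν)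
      = ∫⁻ y, F y 0 ∂(Measure.pi fun _ : Fin (n + 1) => ν) := by
    intro j
    have hmap : (Measure.pi fun _ : Fin (n + 1) => ν).map (fun y i => y (Equiv.swap 0 j i))
        = Measure.pi fun _ : Fin (n + 1) => ν := by
      rw [← Measure.infinitePi_eq_pi]
      exact Measure.map_infinitePi_infinitePi_of_inj (P := fun _ : Fin (n + 1) => ν)
        (Equiv.swap 0 j).injective
    conv_rhs => rw [← hmap]
    rw [lintegral_map hF (by fun_prop)]
    exact lintegral_congr fun y => (hswap y j).symm
  simp [h]

theorem selectProb_swap (z : Sph d) {n : ℕ} (y : Fin (n + 1) → Sph d) (j : Fin (n + 1)) :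
    selectProb ω z (fun i => y (Equiv.swap 0 j i)) 0 = selectProb ω z y j := by
  simp only [selectProb, Equiv.swap_apply_left]
  rw [Equiv.sum_comp (Equiv.swap 0 j) fun i => (ω z (y i) : ℝ≥0∞)]

theorem meanAccept_swap (z : Sph d) {n : ℕ} (y : Fin (n + 1) → Sph d) (j : Fin (n + 1)) :
    meanAccept R h π ω z (fun i => y (Equiv.swap 0 j i)) 0 = meanAccept R h π ω z y j := by
  simp only [meanAccept, smtmAccept, Equiv.swap_apply_left]
  rw [Equiv.sum_comp (Equiv.swap 0 j) fun i => (ω z (y i) : ℝ≥0∞)]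

/-- By exchangeability the sum over the selected candidate consists of `n + 1` equal terms. A single
infinite sequence serves all `n`, so that almost sure limits make sense; the shift to `n + 1`
guarantees that candidate `0` exists. -/
theorem lintegral_smtmMove_succ (hπ : Measurable π) (hω : Measurable (Function.uncurry ω)) (n : ℕ)
    (z : Sph d) {g : Sph d → ℝ≥0∞} (hg : Measurable g) :
    ∫⁻ y, g y ∂(smtmMove R h π ω (n + 1) z)
      = ∫⁻ Y, g (Y 0) * (((n + 1 : ℕ) : ℝ≥0∞) *
            selectProb ω z (fun i : Fin (n + 1) => Y i) 0 *
            meanAccept R h π ω z (fun i : Fin (n + 1) => Y i) 0)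
          ∂(Measure.infinitePi fun _ : ℕ => QS d h z) := by
  have hF : Measurable fun y : Fin (n + 1) → Sph d =>
      g (y 0) * (selectProb ω z y 0 * meanAccept R h π ω z y 0) :=
    (hg.comp (measurable_pi_apply 0)).mul
      ((measurable_selectProb_comp hω measurable_const measurable_id 0).mul
        (measurable_meanAccept_comp R h hπ hω z measurable_id 0))
  rw [lintegral_smtmMove hπ hω _ z hg, sum_lintegral_pi_eq_of_swap _ (fun y j =>
    g (y j) * (selectProb ω z y j * meanAccept R h π ω z y j)) hF fun y j => by
      simp only [selectProb_swap, meanAccept_swap, Equiv.swap_apply_left],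
    ← lintegral_const_mul _ hF,
    ← (measurePreserving_infinitePi_fin (QS d h z) (n + 1)).lintegral_comp (hF.const_mul _)]
  refine lintegral_congr fun Y => ?_
  simp only [Fin.val_zero]
  ring

/-- Selection probabilities sum to at most `1` (to `0` when all weights vanish, since `0 / 0 = 0`).
This is the mass bound of the Scheffé argument. -/
theorem lintegral_selectProb_succ_le (hω : Measurable (Function.uncurry ω)) (n : ℕ) (z : Sph d) :
    ∫⁻ Y, ((n + 1 : ℕ) : ℝ≥0∞) * selectProb ω z (fun i : Fin (n + 1) => Y i) 0
      ∂(Measure.infinitePi fun _ : ℕ => QS d h z) ≤ 1 := by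
  have hF : ∀ j, Measurable fun y : Fin (n + 1) → Sph d => selectProb ω z y j := fun j =>
    measurable_selectProb_comp hω measurable_const measurable_id j
  rw [(measurePreserving_infinitePi_fin (QS d h z) (n + 1)).lintegral_comp
    ((hF 0).const_mul ((n + 1 : ℕ) : ℝ≥0∞)), lintegral_const_mul _ (hF 0),
    ← sum_lintegral_pi_eq_of_swap _ (fun y j => selectProb ω z y j) (hF 0) (selectProb_swap z),
    ← lintegral_finsetSum _ fun j _ => hF j]
  refine (lintegral_mono (g := fun _ => 1) fun y => ?_).trans (by simp)
  simp only [selectProb, div_eq_mul_inv]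
  rw [← Finset.sum_mul]
  exact ENNReal.mul_inv_le_one _

theorem natCast_succ_mul_div (n : ℕ) (a s : ℝ≥0∞) :
    ((n + 1 : ℕ) : ℝ≥0∞) * (a / s) = a / (s / ((n + 1 : ℕ) : ℝ≥0∞)) := by
  have h0 : ((n + 1 : ℕ) : ℝ≥0∞) ≠ 0 := by simp
  have h1 : ((n + 1 : ℕ) : ℝ≥0∞) ≠ ∞ := ENNReal.natCast_ne_top _
  rw [div_eq_mul_inv a, div_eq_mul_inv a, div_eq_mul_inv s, ENNReal.mul_inv (Or.inr (by simp))
    (Or.inr (by simp)), inv_inv]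
  ring

/-- For the reverse sum, which has `n` draws and the extra weight of the current state, but is
normalised by the number `n + 1` of candidates. -/
theorem tendsto_add_div_succ {a : ℕ → ℝ≥0∞} {W c : ℝ≥0∞} (hc : c ≠ ∞)
    (ha : Tendsto (fun n : ℕ => a n / n) atTop (𝓝 W)) :
    Tendsto (fun n : ℕ => (a n + c) / ((n + 1 : ℕ) : ℝ≥0∞)) atTop (𝓝 W) := by
  have h1 : Tendsto (fun n : ℕ => c / ((n + 1 : ℕ) : ℝ≥0∞)) atTop (𝓝 0) := by
    have := (ENNReal.Tendsto.const_mul (a := c) ENNReal.tendsto_inv_nat_nhds_zero (Or.inr hc))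
    simpa [div_eq_mul_inv, Function.comp_def] using this.comp (tendsto_add_atTop_nat 1)
  have h2 : Tendsto (fun n : ℕ => a n / ((n + 1 : ℕ) : ℝ≥0∞)) atTop (𝓝 W) := by
    have h3 : Tendsto (fun n : ℕ => (1 + (n : ℝ≥0∞)⁻¹)) atTop (𝓝 1) := by
      simpa using (tendsto_const_nhds (x := (1 : ℝ≥0∞))).add ENNReal.tendsto_inv_nat_nhds_zero
    have h4 := ENNReal.Tendsto.div ha (Or.inr one_ne_zero) h3 (Or.inl ENNReal.one_ne_top)
    rw [div_one] at h4
    refine h4.congr' ?_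
    filter_upwards [eventually_gt_atTop 0] with n hn
    have h0 : (n : ℝ≥0∞) ≠ 0 := by simpa using hn.ne'
    have ht : (n : ℝ≥0∞) ≠ ∞ := ENNReal.natCast_ne_top _
    rw [div_eq_mul_inv, div_eq_mul_inv, div_eq_mul_inv, mul_assoc,
      ← ENNReal.mul_inv (Or.inl h0) (Or.inl ht), mul_add, mul_one, ENNReal.mul_inv_cancel h0 ht]
    push_cast
    rfl
  simpa [ENNReal.add_div] using h2.add h1

/-- Multiplying both parts of the acceptance ratio by `n + 1` turns the sums of weights into
averages. The forward averages converge by `hY`, the reverse ones by the law of large numbers at `Y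
0`, and the bound by `1` allows passing to the limit in the mean. -/
theorem tendsto_meanAccept (hπ : Measurable π) (hω : Measurable (Function.uncurry ω)) {z : Sph d}
    (hz0 : piS R π z ≠ 0) (hz1 : piS R π z ≠ ∞)
    (hW0 : meanWeight h ω z ≠ 0) (hW1 : meanWeight h ω z ≠ ∞) {Y : ℕ → Sph d}
    (hY : Tendsto (fun n : ℕ => (∑ i : Fin n, (ω z (Y i) : ℝ≥0∞)) / n) atTop
      (𝓝 (meanWeight h ω z)))
    (hy : ω z (Y 0) ≠ 0)
    (hyW : piS R π (Y 0) ≠ 0 → meanWeight h ω (Y 0) ≠ 0 ∧ meanWeight h ω (Y 0) ≠ ∞) :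
    Tendsto (fun n : ℕ => meanAccept R h π ω z (fun i : Fin (n + 1) => Y i) 0) atTop
      (𝓝 (limitAccept R h π ω z (Y 0))) := by
  -- A candidate of zero target density is never accepted, before or in the limit, so no control of
  -- its mean weight is needed.
  by_cases hp : piS R π (Y 0) = 0
  · simp [meanAccept, smtmAccept, limitAccept, hp]
  obtain ⟨hV0, hV1⟩ := hyW hp
  have hmeas : ∀ n : ℕ, Measurable fun w : Fin n → Sph d =>
      smtmAccept (N := n + 1) R π ω z (fun i : Fin (n + 1) => Y i) 0 w := fun n =>
    measurable_smtmAccept_comp (N := n + 1) R hπ hω measurable_const measurable_const measurable_id 0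
  have heq : ∀ n : ℕ, meanAccept R h π ω z (fun i : Fin (n + 1) => Y i) 0
      = ∫⁻ w : ℕ → Sph d, smtmAccept (N := n + 1) R π ω z (fun i : Fin (n + 1) => Y i) 0
          (fun i : Fin n => w i) ∂(Measure.infinitePi fun _ : ℕ => QS d h (Y 0)) := fun n =>
    ((measurePreserving_infinitePi_fin (QS d h (Y 0)) n).lintegral_comp (hmeas n)).symm
  have hlim : limitAccept R h π ω z (Y 0)
      = ∫⁻ _, limitAccept R h π ω z (Y 0) ∂(Measure.infinitePi fun _ : ℕ => QS d h (Y 0)) := by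
    simp
  rw [hlim]
  simp only [heq]
  refine tendsto_lintegral_of_dominated_convergence (fun _ => 1)
    (fun n => measurable_smtmAccept_comp (N := n + 1) R hπ hω measurable_const measurable_const
      (by fun_prop) 0) (fun n => ae_of_all _ fun w => smtmAccept_le_one _ _ _ _)
    (by simp) ?_
  filter_upwards [ae_tendsto_average (f := ω (Y 0)) (hω.comp measurable_prodMk_left) hV1] with w hw
  have hT := tendsto_add_div_succ (c := ω (Y 0) z) ENNReal.coe_ne_top hw
  have hS := (tendsto_add_atTop_iff_nat 1).2 hY
  have hq0 : piS R π z * ω z (Y 0) ≠ 0 := mul_ne_zero hz0 (by simpa using hy)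
  have hq1 : piS R π z * ω z (Y 0) ≠ ∞ := ENNReal.mul_ne_top hz1 ENNReal.coe_ne_top
  have hnum := ENNReal.Tendsto.div (tendsto_const_nhds (x := piS R π (Y 0) * ω (Y 0) z))
    (Or.inr hV0) hT (Or.inl hV1)
  have hden := ENNReal.Tendsto.div (tendsto_const_nhds (x := piS R π z * ω z (Y 0)))
    (Or.inr hW0) hS (Or.inl hW1)
  have hrat := ENNReal.Tendsto.div hnum (Or.inr (ENNReal.div_ne_zero.2 ⟨hq0, hW1⟩)) hden
    (Or.inl (ENNReal.div_ne_top hq1 hW0))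
  refine ((tendsto_const_nhds (x := (1 : ℝ≥0∞))).min hrat).congr fun n => ?_
  rw [← natCast_succ_mul_div, ← natCast_succ_mul_div,
    ENNReal.mul_div_mul_left _ _ (by simp) (ENNReal.natCast_ne_top _)]
  rfl

/-- The integrand has no evident fixed majorant. It is at most `(n + 1) · selectProb`, whose mean
does not exceed the mean `1` of its limit `ω(z, Y 0) / W(z)`, as
`tendsto_lintegral_of_le_of_lintegral_le` requires. -/
theorem boundedlyConvergesTo_smtmMove (hπ : Measurable π) (hω : Measurable (Function.uncurry ω))
    {z : Sph d} (hz0 : piS R π z ≠ 0) (hz1 : piS R π z ≠ ∞)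
    (hW0 : meanWeight h ω z ≠ 0) (hW1 : meanWeight h ω z ≠ ∞)
    (hy : ∀ᵐ y ∂(QS d h z), ω z y ≠ 0 ∧
      (piS R π y ≠ 0 → meanWeight h ω y ≠ 0 ∧ meanWeight h ω y ≠ ∞)) :
    BoundedlyConvergesTo (fun N => smtmMove R h π ω N z)
      ((QS d h z).withDensity (limitDensity R h π ω z)) := by
  intro g g' hg hg' hle hlim
  rw [← tendsto_add_atTop_iff_nat 1]
  simp only [lintegral_smtmMove_succ hπ hω _ z (hg _)]
  have hρ := measurable_limitDensity R h hπ hω z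
  have hev := measurePreserving_eval_infinitePi (fun _ : ℕ => QS d h z) 0
  rw [ae_withDensity_iff hρ] at hlim
  rw [lintegral_withDensity_eq_lintegral_mul _ hρ hg', ← hev.lintegral_comp (hρ.mul hg')]
  have hr : ∀ n : ℕ, Measurable fun (Y : ℕ → Sph d) (i : Fin (n + 1)) => Y i := by fun_prop
  have hsel : ∀ n : ℕ, Measurable fun Y : ℕ → Sph d =>
      ((n + 1 : ℕ) : ℝ≥0∞) * selectProb ω z (fun i : Fin (n + 1) => Y i) 0 := fun n =>
    (measurable_selectProb_comp hω measurable_const (hr n) 0).const_mul _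
  have hacc : ∀ n : ℕ, Measurable fun Y : ℕ → Sph d =>
      meanAccept R h π ω z (fun i : Fin (n + 1) => Y i) 0 := fun n =>
    measurable_meanAccept_comp R h hπ hω z (hr n) 0
  have hωz : Measurable fun y => (ω z y : ℝ≥0∞) := measurable_weight hω measurable_const measurable_id
  have hG' : ∫⁻ Y, (ω z (Y 0) : ℝ≥0∞) / meanWeight h ω z
      ∂(Measure.infinitePi fun _ : ℕ => QS d h z) = 1 := by
    refine (hev.lintegral_comp (hωz.div_const (meanWeight h ω z))).trans ?_
    simp only [div_eq_mul_inv]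
    rw [lintegral_mul_const _ hωz]
    exact ENNReal.mul_inv_cancel hW0 hW1
  have havg := ae_tendsto_average (ν := QS d h z) (f := ω z) (hω.comp measurable_prodMk_left) hW1
  have hselLim : ∀ᵐ Y ∂(Measure.infinitePi fun _ : ℕ => QS d h z),
      Tendsto (fun n : ℕ => ((n + 1 : ℕ) : ℝ≥0∞) * selectProb ω z (fun i : Fin (n + 1) => Y i) 0)
        atTop (𝓝 ((ω z (Y 0) : ℝ≥0∞) / meanWeight h ω z)) := by
    filter_upwards [havg] with Y hY
    have hS := (tendsto_add_atTop_iff_nat 1).2 hY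
    simp only [selectProb, natCast_succ_mul_div]
    exact ENNReal.Tendsto.div tendsto_const_nhds (Or.inr hW0) hS (Or.inl hW1)
  refine tendsto_lintegral_of_le_of_lintegral_le
    (G := fun n Y => ((n + 1 : ℕ) : ℝ≥0∞) * selectProb ω z (fun i : Fin (n + 1) => Y i) 0)
    (G' := fun Y => (ω z (Y 0) : ℝ≥0∞) / meanWeight h ω z)
    (fun n => ((hg _).comp (measurable_pi_apply 0)).mul ((hsel n).mul (hacc n))) hsel
    ((hωz.comp (measurable_pi_apply 0)).div_const _) (fun n => ae_of_all _ fun Y => ?_) ?_ hselLim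
    (by rw [hG']; exact ENNReal.one_ne_top)
    (fun n => by rw [hG']; exact lintegral_selectProb_succ_le hω n z)
  · exact (mul_le_of_le_one_left zero_le (hle _ _)).trans
      (mul_le_of_le_one_right zero_le (meanAccept_le_one _ _ _))
  · filter_upwards [havg, hselLim, hev.quasiMeasurePreserving.ae hy,
      hev.quasiMeasurePreserving.ae hlim] with Y hY hsY hyY hgY
    have hA := tendsto_meanAccept hπ hω hz0 hz1 hW0 hW1 hY hyY.1 hyY.2
    have hA1 : limitAccept R h π ω z (Y 0) ≠ ∞ :=
      ((min_le_left _ _).trans_lt ENNReal.one_lt_top).ne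
    have hprod := ENNReal.Tendsto.mul hsY (Or.inr hA1) hA
      (Or.inr (ENNReal.div_ne_top ENNReal.coe_ne_top hW0))
    change Tendsto _ _ (𝓝 (limitDensity R h π ω z (Y 0))) at hprod
    change Tendsto _ _ (𝓝 (limitDensity R h π ω z (Y 0) * g' (Y 0)))
    have hρ1 : limitDensity R h π ω z (Y 0) ≠ ∞ :=
      ENNReal.mul_ne_top (ENNReal.div_ne_top ENNReal.coe_ne_top hW0) hA1
    -- Convergence of `g n` is known only where the limit density is nonzero. Where it is zero, the
    -- remaining factors tend to `0` and `g n ≤ 1`.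
    by_cases h0 : limitDensity R h π ω z (Y 0) = 0
    · rw [h0] at hprod ⊢
      rw [zero_mul]
      exact tendsto_of_tendsto_of_tendsto_of_le_of_le tendsto_const_nhds hprod
        (fun _ => zero_le) fun n => mul_le_of_le_one_left zero_le (hle _ _)
    · have hg0 := (tendsto_add_atTop_iff_nat 1).2 (hgY h0)
      have hg1 : g' (Y 0) ≠ ∞ :=
        ((le_of_tendsto' (hgY h0) fun n => hle n _).trans_lt ENNReal.one_lt_top).ne
      rw [mul_comm]
      exact ENNReal.Tendsto.mul hg0 (Or.inr hρ1) hprod (Or.inr hg1)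

end ManyCandidates

end SMTM

namespace SMTM

/-! ### Splitting off the last coordinate, and determinants from Gram matrices. -/

section Coordinates

/-- The first `d` coordinates of a vector of `ℝ^(d+1)`. -/
noncomputable def initCoords {d : ℕ} (p : Euc (d + 1)) : Euc d :=
  WithLp.toLp 2 fun i : Fin d => p i.castSucc

/-- Splitting off the last coordinate preserves Lebesgue measure. -/
theorem measurePreserving_last_initCoords (d : ℕ) :
    MeasurePreserving (fun p : Euc (d + 1) => (p (Fin.last d), initCoords p)) := by
  have h1 := PiLp.volume_preserving_ofLp (Fin (d + 1))
  have h2 := volume_preserving_piFinSuccAbove (fun _ : Fin (d + 1) => ℝ) (Fin.last d)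
  have h3 := (MeasurePreserving.id (volume : Measure ℝ)).prod
    (PiLp.volume_preserving_toLp (Fin d))
  convert h3.comp (h2.comp h1) using 1
  · funext p
    simp [initCoords]
    rfl
  · rfl

/-- The inner products of the images of the basis are the entries of `Mᵀ M`, whose determinant is
`det M ^ 2`. -/
theorem sq_det_eq_prod_of_inner_single {n : ℕ} (L : Euc n →L[ℝ] Euc n) (v : Fin n → ℝ)
    (hL : ∀ i j, inner ℝ (L (EuclideanSpace.single i 1)) (L (EuclideanSpace.single j 1))
      = if i = j then v i else 0) : L.det ^ 2 = ∏ i, v i := by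
  set b := (EuclideanSpace.basisFun (Fin n) ℝ).toBasis with hb
  set M := LinearMap.toMatrix b b (L : Euc n →ₗ[ℝ] Euc n) with hM
  have hdet : L.det = M.det := (LinearMap.det_toMatrix b _).symm
  have hmul : M.transpose * M = Matrix.diagonal v := by
    ext i j
    have h := hL i j
    rw [Matrix.mul_apply, Matrix.diagonal_apply, ← h, PiLp.inner_apply]
    refine Finset.sum_congr rfl fun k _ => ?_
    simp [hM, hb, LinearMap.toMatrix_apply, mul_comm]
  rw [hdet, sq]
  nth_rewrite 1 [← Matrix.det_transpose]
  rw [← Matrix.det_mul, hmul, Matrix.det_diagonal]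

end Coordinates

/-! ### The surface measure in stereographic coordinates. -/

section Jacobian

open scoped Pointwise

variable {d : ℕ} {R : ℝ}

/-- The conformal factor `2R / (R² + ‖x‖²)` of inverse stereographic projection. -/
noncomputable def conformalFactor {d : ℕ} (R : ℝ) (x : Euc d) : ℝ := 2 * R / (‖x‖ ^ 2 + R ^ 2)

theorem conformalFactor_pos (hR : 0 < R) (x : Euc d) : 0 < conformalFactor R x := by
  unfold conformalFactor; positivity

theorem measurable_conformalFactor : Measurable (conformalFactor (d := d) R) := by
  unfold conformalFactor; fun_prop

/-- The map `(x, r) ↦ r • SP⁻¹(x)`. -/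
noncomputable def conePoint {d : ℕ} (R : ℝ) (p : Euc (d + 1)) : Euc (d + 1) :=
  p (Fin.last d) • stereoInvVec R (initCoords p)

theorem stereo_stereoInv (hR : 0 < R) (x : Euc d) : stereo R (stereoInv hR x) = x := by
  have hpos : 0 < ‖x‖ ^ 2 + R ^ 2 := by positivity
  ext i
  simp only [stereo, stereoInv, stereoInvVec, Fin.snoc_castSucc, Fin.snoc_last]
  have h : 1 - (‖x‖ ^ 2 - R ^ 2) / (‖x‖ ^ 2 + R ^ 2) = 2 * R ^ 2 / (‖x‖ ^ 2 + R ^ 2) := by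
    field_simp; ring
  rw [h]
  field_simp

theorem stereoInv_stereo (hR : 0 < R) {z : Sph d} (hz : (z : Euc (d + 1)) (Fin.last d) ≠ 1) :
    stereoInv hR (stereo R z) = z := by
  have h1 : ∑ i : Fin d, (z : Euc (d + 1)) i.castSucc ^ 2 + (z : Euc (d + 1)) (Fin.last d) ^ 2
      = 1 := by
    have h := EuclideanSpace.real_norm_sq_eq (z : Euc (d + 1))
    rw [Fin.sum_univ_castSucc] at h
    rw [← h]
    simp
  set t := (z : Euc (d + 1)) (Fin.last d) with ht
  have ht0 : 1 - t ≠ 0 := sub_ne_zero.2 (Ne.symm hz)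
  have hn : ‖stereo R z‖ ^ 2 = R ^ 2 * (1 + t) / (1 - t) := by
    rw [EuclideanSpace.real_norm_sq_eq]
    simp only [stereo, ← ht]
    have : ∀ i : Fin d, (R * (z : Euc (d + 1)) i.castSucc / (1 - t)) ^ 2
        = R ^ 2 / (1 - t) ^ 2 * (z : Euc (d + 1)) i.castSucc ^ 2 := fun i => by
      rw [div_pow, mul_pow]; ring
    simp only [this]
    rw [← Finset.mul_sum, eq_sub_of_add_eq h1]
    field_simp
    ring
  have hs : ‖stereo R z‖ ^ 2 + R ^ 2 = 2 * R ^ 2 / (1 - t) := by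
    rw [hn]; field_simp; ring
  ext i
  simp only [stereoInv, stereoInvVec]
  refine Fin.lastCases ?_ (fun j => ?_) i
  · rw [Fin.snoc_last, hs, hn, ← ht]
    field_simp
    ring
  · rw [Fin.snoc_castSucc, hs]
    simp only [stereo, ← ht]
    field_simp

/-- Inverse stereographic projection as an inversion centred at the pole `e`: with `w = (x, -R)`, it
is `e + 2R w / ‖w‖²`. This form can be differentiated without coordinates. -/
theorem stereoInvVec_eq (hR : 0 < R) (p : Euc (d + 1)) :
    stereoInvVec R (initCoords p) = EuclideanSpace.single (Fin.last d) 1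
      + (2 * R * (‖p - (p (Fin.last d) + R) • EuclideanSpace.single (Fin.last d) (1 : ℝ)‖ ^ 2)⁻¹) •
        (p - (p (Fin.last d) + R) • EuclideanSpace.single (Fin.last d) (1 : ℝ)) := by
  have hn : ‖p - (p (Fin.last d) + R) • EuclideanSpace.single (Fin.last d) (1 : ℝ)‖ ^ 2
      = ‖initCoords p‖ ^ 2 + R ^ 2 := by
    rw [EuclideanSpace.real_norm_sq_eq, EuclideanSpace.real_norm_sq_eq, Fin.sum_univ_castSucc]
    simp [initCoords, Fin.castSucc_ne_last]
  have hpos : 0 < ‖initCoords p‖ ^ 2 + R ^ 2 := by positivity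
  rw [hn]
  ext i
  simp only [stereoInvVec]
  refine Fin.lastCases ?_ (fun j => ?_) i
  · rw [Fin.snoc_last]
    simp
    field_simp
    ring
  · rw [Fin.snoc_castSucc]
    simp [initCoords, Fin.castSucc_ne_last]
    field_simp

/-- Inversion is conformal: at height `r` the derivative scales the first `d` directions by `c = r ·
conformalFactor`, and it sends the last one to a unit vector orthogonal to their images. The Gram
matrix is thus `diag(c², …, c², 1)`. -/
theorem exists_hasFDerivAt_conePoint (hR : 0 < R) (p : Euc (d + 1)) (hp : 0 < p (Fin.last d)) :
    ∃ L : Euc (d + 1) →L[ℝ] Euc (d + 1), HasFDerivAt (conePoint R) L p ∧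
      |L.det| = (p (Fin.last d) * conformalFactor R (initCoords p)) ^ d := by
  set e : Euc (d + 1) := EuclideanSpace.single (Fin.last d) 1 with he
  set ℓ : Euc (d + 1) →L[ℝ] ℝ := EuclideanSpace.proj (Fin.last d) with hℓ
  set w : Euc (d + 1) := p - (p (Fin.last d) + R) • e with hw
  have hee : inner ℝ e e = 1 := by simp [he]
  have hne : ‖w‖ ^ 2 = ‖initCoords p‖ ^ 2 + R ^ 2 := by
    rw [EuclideanSpace.real_norm_sq_eq, EuclideanSpace.real_norm_sq_eq, Fin.sum_univ_castSucc]
    simp [initCoords, hw, he, Fin.castSucc_ne_last]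
  have hn0 : ‖w‖ ^ 2 ≠ 0 := by rw [hne]; positivity
  have hwe : inner ℝ w e = - R := by
    simp [hw, he, inner_sub_left, inner_smul_left, EuclideanSpace.inner_single_right]
  have hfun : conePoint R = fun q : Euc (d + 1) => ℓ q • (e +
      (2 * R * (‖q - (ℓ q + R) • e‖ ^ 2)⁻¹) • (q - (ℓ q + R) • e)) := by
    funext q
    rw [conePoint, stereoInvVec_eq hR]
    rfl
  have hℓd : HasFDerivAt (fun q => ℓ q) ℓ p := ℓ.hasFDerivAt
  have hwd : HasFDerivAt (fun q => q - (ℓ q + R) • e)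
      (ContinuousLinearMap.id ℝ (Euc (d + 1)) - ℓ.smulRight e) p :=
    (hasFDerivAt_id p).sub ((hℓd.add_const R).smul_const e)
  have hnd := hwd.norm_sq
  have hid := (hasDerivAt_inv hn0).comp_hasFDerivAt p hnd
  have hsd := ((hid.const_mul (2 * R)).smul hwd).const_add e
  have hL := hℓd.smul hsd
  rw [hfun]
  obtain ⟨L, hL', hLa⟩ : ∃ L : Euc (d + 1) →L[ℝ] Euc (d + 1), HasFDerivAt (fun q => ℓ q • (e +
      (2 * R * (‖q - (ℓ q + R) • e‖ ^ 2)⁻¹) • (q - (ℓ q + R) • e))) L p ∧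
      ∀ a, L a = ℓ a • (e + (2 * R * (‖w‖ ^ 2)⁻¹) • w) + p (Fin.last d) •
      ((2 * R * (‖w‖ ^ 2)⁻¹) • (a - ℓ a • e) +
        (2 * R * (-((‖w‖ ^ 2) ^ 2)⁻¹ * (2 * inner ℝ w (a - ℓ a • e)))) • w) := by
    refine ⟨_, hL, fun a => ?_⟩
    have hp' : ℓ p = p (Fin.last d) := rfl
    simp only [hp', _root_.add_apply, _root_.smul_apply,
      ContinuousLinearMap.smulRight_apply, ContinuousLinearMap.comp_apply,
      _root_.sub_apply, ContinuousLinearMap.id_apply, innerSL_apply_apply,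
      Function.comp_apply, Pi.smul_apply', smul_eq_mul, nsmul_eq_mul, Nat.cast_ofNat]
    exact add_comm _ _
  refine ⟨L, hL', ?_⟩
  set c := p (Fin.last d) * conformalFactor R (initCoords p) with hc
  have hc' : c = p (Fin.last d) * (2 * R / ‖w‖ ^ 2) := by rw [hc, conformalFactor, hne]
  have hc0 : 0 ≤ c := mul_nonneg hp.le (conformalFactor_pos hR _).le
  have hℓe : ∀ a, inner ℝ e a = ℓ a := fun a => by
    simp [he, hℓ, EuclideanSpace.inner_single_left]
  have hℓ1 : ℓ e = 1 := by rw [← hℓe, hee]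
  -- Here `a - ℓ a • e` is the horizontal part of `a`; the cross terms cancel because `⟪w, e⟫ = -R`.
  have hinner : ∀ a b, inner ℝ (L a) (L b)
      = c ^ 2 * inner ℝ (a - ℓ a • e) (b - ℓ b • e) + ℓ a * ℓ b := by
    intro a b
    rw [hLa, hLa]
    have ha : inner ℝ e (a - ℓ a • e) = 0 := by
      rw [inner_sub_right, inner_smul_right, hee, hℓe]; ring
    have hb : inner ℝ e (b - ℓ b • e) = 0 := by
      rw [inner_sub_right, inner_smul_right, hee, hℓe]; ring
    generalize a - ℓ a • e = a' at ha ⊢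
    generalize b - ℓ b • e = b' at hb ⊢
    have hew : inner ℝ e w = -R := by rw [real_inner_comm, hwe]
    have ha' : inner ℝ a' e = 0 := by rw [real_inner_comm, ha]
    have haw : inner ℝ a' w = inner ℝ w a' := real_inner_comm _ _
    have hww : inner ℝ w w = ‖w‖ ^ 2 := real_inner_self_eq_norm_sq w
    rw [hc']
    generalize ‖w‖ ^ 2 = n at hn0 hww ⊢
    simp only [inner_add_left, inner_add_right, inner_smul_left, inner_smul_right, hee, hwe, hew,
      hb, ha', haw, hww, conj_trivial]
    field_simp
    ring
  have hdet := sq_det_eq_prod_of_inner_single L (Fin.snoc (α := fun _ => ℝ) (fun _ => c ^ 2) 1) (by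
    intro i j
    rw [hinner]
    have hs : ∀ i, ℓ (EuclideanSpace.single i 1) = if i = Fin.last d then 1 else 0 := fun i => by
      simp [hℓ, eq_comm]
    have hin : inner ℝ (EuclideanSpace.single i (1 : ℝ) - ℓ (EuclideanSpace.single i 1) • e)
        (EuclideanSpace.single j (1 : ℝ) - ℓ (EuclideanSpace.single j 1) • e)
        = (if i = j then 1 else 0) - ℓ (EuclideanSpace.single i 1) * ℓ (EuclideanSpace.single j 1) := by
      have h1 : ∀ a, inner ℝ a e = ℓ a := fun a => by rw [real_inner_comm, hℓe]
      simp only [inner_sub_left, inner_sub_right, inner_smul_left, inner_smul_right, hℓe, h1,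
        conj_trivial]
      rw [EuclideanSpace.inner_single_left]
      simp [hℓ1]
    rw [hin, hs, hs]
    refine Fin.lastCases ?_ (fun i => ?_) i <;> refine Fin.lastCases ?_ (fun j => ?_) j
    · simp
    · simp [Fin.castSucc_ne_last, (Fin.castSucc_ne_last _).symm]
    · simp [Fin.castSucc_ne_last]
    · simp [Fin.castSucc_ne_last])
  rw [Fin.prod_univ_castSucc] at hdet
  simp only [Fin.snoc_castSucc, Fin.snoc_last, Finset.prod_const, Finset.card_univ,
    Fintype.card_fin, mul_one] at hdet
  rw [← abs_of_nonneg (pow_nonneg hc0 d), ← sq_eq_sq_iff_abs_eq_abs, hdet]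
  ring

theorem norm_conePoint (hR : 0 < R) {p : Euc (d + 1)} (hp : 0 < p (Fin.last d)) :
    ‖conePoint R p‖ = p (Fin.last d) := by
  rw [conePoint, norm_smul, mem_sphere_zero_iff_norm.1 (stereoInvVec_mem hR _), mul_one,
    Real.norm_of_nonneg hp.le]

theorem stereoInv_injective (hR : 0 < R) : Function.Injective (stereoInv (d := d) hR) :=
  Function.LeftInverse.injective (stereo_stereoInv hR)

theorem injOn_conePoint (hR : 0 < R) :
    Set.InjOn (conePoint (d := d) R) {p | 0 < p (Fin.last d)} := by
  intro p hp q hq hpq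
  have h1 : p (Fin.last d) = q (Fin.last d) := by
    rw [← norm_conePoint hR hp, ← norm_conePoint hR hq, hpq]
  have h2 : initCoords p = initCoords q := by
    refine stereoInv_injective hR (Subtype.ext ?_)
    have h3 : p (Fin.last d) • stereoInvVec R (initCoords p)
        = q (Fin.last d) • stereoInvVec R (initCoords q) := hpq
    rw [← h1] at h3
    exact smul_right_injective _ (ne_of_gt hp) h3
  ext i
  refine Fin.lastCases h1 (fun j => ?_) i
  exact congrArg (fun x : Euc d => x j) h2

theorem stereoInv_last_ne_one (hR : 0 < R) (x : Euc d) :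
    (stereoInv hR x : Euc (d + 1)) (Fin.last d) ≠ 1 := by
  have hpos : 0 < ‖x‖ ^ 2 + R ^ 2 := by positivity
  simp only [stereoInv, stereoInvVec, Fin.snoc_last]
  rw [Ne, div_eq_one_iff_eq hpos.ne']
  intro h
  nlinarith [sq_pos_of_pos hR]

/-- The surface measure is defined through the volume of the cone over `B`; in the coordinates of
`conePoint` that cone is a product set. The pole is excluded because `stereoInv` misses it. -/
theorem Ioo_smul_eq_image_conePoint (hR : 0 < R) {B : Set (Sph d)}
    (hB : ∀ z ∈ B, (z : Euc (d + 1)) (Fin.last d) ≠ 1) :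
    Set.Ioo (0 : ℝ) 1 • ((↑) '' B : Set (Euc (d + 1)))
      = conePoint R '' {p | p (Fin.last d) ∈ Set.Ioo (0 : ℝ) 1 ∧
          stereoInv hR (initCoords p) ∈ B} := by
  ext y
  simp only [Set.mem_smul, Set.mem_image, Set.mem_ofPred_eq]
  constructor
  · rintro ⟨r, hr, _, ⟨z, hz, rfl⟩, rfl⟩
    have hi : initCoords (WithLp.toLp 2 (Fin.snoc (α := fun _ => ℝ) (stereo R z) r) : Euc (d + 1))
        = stereo R z := by
      ext i
      simp [initCoords]
    refine ⟨WithLp.toLp 2 (Fin.snoc (α := fun _ => ℝ) (stereo R z) r), ⟨by simpa using hr, ?_⟩, ?_⟩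
    · rw [hi, stereoInv_stereo hR (hB z hz)]
      exact hz
    · rw [conePoint, hi]
      have h := congrArg Subtype.val (stereoInv_stereo hR (hB z hz))
      simp only [stereoInv] at h
      rw [h]
      simp
  · rintro ⟨p, ⟨hp, hpB⟩, rfl⟩
    exact ⟨_, hp, _, ⟨_, hpB, rfl⟩, rfl⟩

/-- The cone over the pole lies in a line, which is null in dimension `d + 1 ≥ 2`. -/
theorem surface_northPole (hd : 1 ≤ d) :
    surface d {z : Sph d | (z : Euc (d + 1)) (Fin.last d) = 1} = 0 := by
  have hm : MeasurableSet {z : Sph d | (z : Euc (d + 1)) (Fin.last d) = 1} :=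
    measurableSet_eq_fun (by fun_prop) measurable_const
  rw [surface, Measure.toSphere_apply' _ hm]
  set e : Euc (d + 1) := EuclideanSpace.single (Fin.last d) 1 with he
  have hsub : Set.Ioo (0 : ℝ) 1 • ((↑) '' {z : Sph d | (z : Euc (d + 1)) (Fin.last d) = 1} :
      Set (Euc (d + 1))) ⊆ (Submodule.span ℝ {e} : Set (Euc (d + 1))) := by
    rintro _ ⟨r, -, _, ⟨z, hz, rfl⟩, rfl⟩
    refine Submodule.smul_mem _ r ?_
    have hze : (z : Euc (d + 1)) = e := by
      have h1 : inner ℝ (z : Euc (d + 1)) e = 1 := by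
        rw [he, EuclideanSpace.inner_single_right]
        simpa using hz
      exact (inner_eq_one_iff_of_norm_eq_one (by simp) (by simp [he])).1 h1
    rw [hze]
    exact Submodule.mem_span_singleton_self e
  have hne : Submodule.span ℝ {e} ≠ ⊤ := by
    intro htop
    have h1 := finrank_span_singleton (K := ℝ) (v := e) (by simp [he])
    rw [htop, finrank_top, finrank_euclideanSpace, Fintype.card_fin] at h1
    omega
  rw [measure_mono_null hsub (Measure.addHaar_submodule _ _ hne), mul_zero]

theorem lintegral_Ioo_pow (d : ℕ) :
    ∫⁻ t in Set.Ioo (0 : ℝ) 1, ENNReal.ofReal (t ^ d) = ((d + 1 : ℕ) : ℝ≥0∞)⁻¹ := by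
  rw [restrict_Ioo_eq_restrict_Ioc, ← ofReal_integral_eq_lintegral_ofReal
    (intervalIntegral.intervalIntegrable_pow d).1, ← intervalIntegral.integral_of_le zero_le_one]
  · rw [integral_pow, ← ENNReal.ofReal_natCast, ← ENNReal.ofReal_inv_of_pos (by positivity)]
    simp
  · filter_upwards [ae_restrict_mem measurableSet_Ioc] with y hy
    exact pow_nonneg hy.1.le _

/-- The surface measure in stereographic coordinates. -/
theorem surface_eq_map_stereoInv (hd : 1 ≤ d) (hR : 0 < R) :
    surface d = ((volume : Measure (Euc d)).withDensity
      fun x => ENNReal.ofReal (conformalFactor R x ^ d)).map (stereoInv hR) := by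
  have hcm : Measurable fun x : Euc d => ENNReal.ofReal (conformalFactor R x ^ d) :=
    (measurable_conformalFactor.pow_const d).ennreal_ofReal
  -- Away from the pole: change of variables on the cone, then Fubini. The radial integral of `t ^
  -- d` is `1 / (d + 1)` and cancels the factor `d + 1` in the definition of the surface measure.
  have hmain : ∀ B : Set (Sph d), MeasurableSet B →
      (∀ z ∈ B, (z : Euc (d + 1)) (Fin.last d) ≠ 1) →
      surface d B = ∫⁻ x in stereoInv hR ⁻¹' B, ENNReal.ofReal (conformalFactor R x ^ d) := by
    intro B hB hBN
    set S : Set (Euc (d + 1)) := {p | p (Fin.last d) ∈ Set.Ioo (0 : ℝ) 1 ∧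
      stereoInv hR (initCoords p) ∈ B} with hS
    have hpre : S = (fun p : Euc (d + 1) => (p (Fin.last d), initCoords p)) ⁻¹'
        (Set.Ioo (0 : ℝ) 1 ×ˢ (stereoInv hR ⁻¹' B)) := rfl
    have hmp := measurePreserving_last_initCoords d
    have hBm : MeasurableSet (stereoInv hR ⁻¹' B) := measurable_stereoInv hR hB
    have hSm : MeasurableSet S := hmp.measurable (measurableSet_Ioo.prod hBm)
    choose! L hL hdet using exists_hasFDerivAt_conePoint (d := d) hR
    rw [surface, Measure.toSphere_apply' _ hB, Ioo_smul_eq_image_conePoint hR hBN,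
      ← lintegral_abs_det_fderiv_eq_addHaar_image volume hSm
        (fun p hp => (hL p hp.1.1).hasFDerivWithinAt)
        ((injOn_conePoint hR).mono fun p hp => hp.1.1)]
    have h1 : ∫⁻ p in S, ENNReal.ofReal |(L p).det|
        = ∫⁻ p in S, ENNReal.ofReal ((p (Fin.last d) * conformalFactor R (initCoords p)) ^ d) :=
      setLIntegral_congr_fun hSm fun p hp => by simp only [hdet p hp.1.1]
    have h2 : Measurable fun q : ℝ × Euc d =>
        ENNReal.ofReal ((q.1 * conformalFactor R q.2) ^ d) := by
      have := measurable_conformalFactor (d := d) (R := R)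
      fun_prop
    rw [h1, hpre, hmp.setLIntegral_comp_preimage (measurableSet_Ioo.prod hBm) h2,
      Measure.volume_eq_prod, ← Measure.prod_restrict, lintegral_prod _ h2.aemeasurable]
    have h3 : ∫⁻ t in Set.Ioo (0 : ℝ) 1, ∫⁻ x in stereoInv hR ⁻¹' B,
          ENNReal.ofReal ((t * conformalFactor R x) ^ d)
        = ∫⁻ t in Set.Ioo (0 : ℝ) 1, ENNReal.ofReal (t ^ d) * ∫⁻ x in stereoInv hR ⁻¹' B,
          ENNReal.ofReal (conformalFactor R x ^ d) := by
      refine setLIntegral_congr_fun measurableSet_Ioo fun t ht => ?_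
      rw [← lintegral_const_mul _ hcm]
      refine lintegral_congr fun x => ?_
      rw [mul_pow, ENNReal.ofReal_mul (pow_nonneg ht.1.le d)]
    rw [h3, lintegral_mul_const _ (by fun_prop), lintegral_Ioo_pow, ← mul_assoc,
      finrank_euclideanSpace, Fintype.card_fin, ENNReal.mul_inv_cancel (by simp)
        (ENNReal.natCast_ne_top _), one_mul]
  ext B hB
  set N := {z : Sph d | (z : Euc (d + 1)) (Fin.last d) = 1} with hN
  have hNm : MeasurableSet N := measurableSet_eq_fun (by fun_prop) measurable_const
  rw [Measure.map_apply (measurable_stereoInv hR) hB,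
    withDensity_apply _ (measurable_stereoInv hR hB),
    ← measure_sdiff_null (surface_northPole hd), hmain _ (hB.diff hNm) fun z hz => hz.2]
  congr 2
  ext x
  simp [hN, stereoInv_last_ne_one hR x]

end Jacobian

end SMTM

namespace SMTM

/-! ### The density of the proposal as a function of the scalar product. -/

section ProposalDensity

variable {d : ℕ}

theorem lintegral_polar (d : ℕ) {F : Euc (d + 1) → ℝ≥0∞} (hF : Measurable F) :
    ∫⁻ x, F x = ∫⁻ y : Sph d,
      (∫⁻ r in Set.Ioi (0 : ℝ), ENNReal.ofReal (r ^ d) * F (r • (y : Euc (d + 1)))) ∂(surface d) := by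
  have hmp := (volume : Measure (Euc (d + 1))).measurePreserving_homeomorphUnitSphereProd
  have hfr : Module.finrank ℝ (Euc (d + 1)) - 1 = d := by simp
  rw [hfr] at hmp
  set e := homeomorphUnitSphereProd (Euc (d + 1))
  have h1 : ∫⁻ x, F x = ∫⁻ x : ({0}ᶜ : Set (Euc (d + 1))), F x
      ∂((volume : Measure (Euc (d + 1))).comap Subtype.val) := by
    rw [lintegral_subtype_comap (measurableSet_singleton _).compl, restrict_compl_singleton]
  have hG : Measurable fun q : Sph d × Set.Ioi (0 : ℝ) => F ((q.2 : ℝ) • (q.1 : Euc (d + 1))) :=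
    hF.comp (by fun_prop)
  have h2 : ∀ x : ({0}ᶜ : Set (Euc (d + 1))),
      F x = (fun q : Sph d × Set.Ioi (0 : ℝ) => F ((q.2 : ℝ) • (q.1 : Euc (d + 1)))) (e x) := by
    intro x
    have h3 := congrArg Subtype.val (e.symm_apply_apply x)
    rw [homeomorphUnitSphereProd_symm_apply_coe] at h3
    simp only [h3]
  rw [h1, lintegral_congr h2, hmp.lintegral_comp hG, lintegral_prod _ hG.aemeasurable]
  refine lintegral_congr fun y => ?_
  have hG' : Measurable fun r : Set.Ioi (0 : ℝ) => F ((r : ℝ) • (y : Euc (d + 1))) :=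
    hF.comp (by fun_prop)
  rw [Measure.volumeIoiPow, lintegral_withDensity_eq_lintegral_mul _ (by fun_prop) hG',
    ← lintegral_subtype_comap measurableSet_Ioi
      fun r => ENNReal.ofReal (r ^ d) * F (r • (y : Euc (d + 1)))]
  rfl

theorem lintegral_prod_pi : ∀ {n : ℕ} {f : Fin n → ℝ → ℝ≥0∞} (_ : ∀ i, Measurable (f i)),
    ∫⁻ x : Fin n → ℝ, ∏ i, f i (x i) = ∏ i, ∫⁻ t, f i t
  | 0, f, _ => by simp [volume_pi]
  | n + 1, f, hf => by
    have hg : Measurable fun q : ℝ × (Fin n → ℝ) => f 0 q.1 * ∏ i, f i.succ (q.2 i) := by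
      have := fun i => hf i
      fun_prop
    have h := (volume_preserving_piFinSuccAbove (fun _ : Fin (n + 1) => ℝ) 0).lintegral_comp hg
    have h2 : ∀ x : Fin (n + 1) → ℝ, ∏ i, f i (x i)
        = (fun q : ℝ × (Fin n → ℝ) => f 0 q.1 * ∏ i, f i.succ (q.2 i))
          (MeasurableEquiv.piFinSuccAbove (fun _ : Fin (n + 1) => ℝ) 0 x) := fun x => by
      simp [Fin.prod_univ_succ, Fin.tail]
    rw [lintegral_congr h2, h, Measure.volume_eq_prod, lintegral_prod_mul (hf 0).aemeasurable
      (g := fun y : Fin n → ℝ => ∏ i, f i.succ (y i)) (Measurable.aemeasurable (by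
        have := fun i => hf i
        fun_prop)), lintegral_prod_pi fun i => hf i.succ, Fin.prod_univ_succ]

/-- The density of the standard Gaussian law of `ℝ^d` at points of squared norm `s`. -/
noncomputable def gaussianDensity (d : ℕ) (s : ℝ) : ℝ≥0∞ :=
  ENNReal.ofReal ((√(2 * Real.pi))⁻¹ ^ d * Real.exp (-s / 2))

theorem measurable_gaussianDensity (d : ℕ) : Measurable (gaussianDensity d) := by
  unfold gaussianDensity; fun_prop

theorem stdGaussian_eq_withDensity (d : ℕ) :
    stdGaussian (Euc d) = volume.withDensity fun u => gaussianDensity d (‖u‖ ^ 2) := by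
  have hpi : (Measure.pi fun _ : Fin d => gaussianReal 0 1)
      = volume.withDensity fun x : Fin d → ℝ => ∏ i, gaussianPDF 0 1 (x i) := by
    refine Measure.pi_eq fun s hs => ?_
    have hind : ∀ x : Fin d → ℝ, (Set.univ.pi s).indicator (fun x => ∏ i, gaussianPDF 0 1 (x i)) x
        = ∏ i, (s i).indicator (gaussianPDF 0 1) (x i) := by
      intro x
      by_cases hx : x ∈ Set.univ.pi s
      · rw [Set.indicator_of_mem hx]
        exact Finset.prod_congr rfl fun i _ => (Set.indicator_of_mem (hx i (Set.mem_univ i)) _).symm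
      · rw [Set.indicator_of_notMem hx]
        simp only [Set.mem_univ_pi, not_forall] at hx
        obtain ⟨i, hi⟩ := hx
        exact (Finset.prod_eq_zero (Finset.mem_univ i) (Set.indicator_of_notMem hi _)).symm
    rw [withDensity_apply _ (MeasurableSet.univ_pi hs), ← lintegral_indicator
      (MeasurableSet.univ_pi hs), lintegral_congr hind,
      lintegral_prod_pi fun i => (measurable_gaussianPDF 0 1).indicator (hs i)]
    refine Finset.prod_congr rfl fun i _ => ?_
    rw [gaussianReal_apply _ one_ne_zero, lintegral_indicator (hs i)]
  have hdens : ∀ x : Fin d → ℝ, ∏ i, gaussianPDF 0 1 (x i)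
      = gaussianDensity d (‖(WithLp.toLp 2 x : Euc d)‖ ^ 2) := by
    intro x
    simp only [gaussianPDF, gaussianPDFReal, gaussianDensity]
    rw [← ENNReal.ofReal_prod_of_nonneg fun i _ => by positivity, Finset.prod_mul_distrib,
      ← Real.exp_sum, EuclideanSpace.real_norm_sq_eq]
    simp [Finset.sum_div, neg_div]
  rw [← map_pi_eq_stdGaussian, hpi]
  have hmp := PiLp.volume_preserving_toLp (Fin d)
  ext s hs
  rw [Measure.map_apply hmp.measurable hs, withDensity_apply _ (hmp.measurable hs),
    withDensity_apply _ hs, lintegral_congr hdens]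
  have hm : Measurable fun u : Euc d => gaussianDensity d (‖u‖ ^ 2) := by
    have := measurable_gaussianDensity d
    fun_prop
  exact hmp.setLIntegral_comp_preimage hs hm

theorem stdGaussian_map_initCoords (d : ℕ) :
    (stdGaussian (Euc (d + 1))).map initCoords = stdGaussian (Euc d) := by
  rw [← map_pi_eq_stdGaussian, ← map_pi_eq_stdGaussian,
    Measure.map_map (measurePreserving_last_initCoords d).measurable.snd
      (WithLp.measurable_toLp 2 _),
    ← Measure.infinitePi_eq_pi, ← Measure.infinitePi_eq_pi,
    ← Measure.map_infinitePi_infinitePi_of_inj (P := fun _ : Fin (d + 1) => gaussianReal 0 1)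
      (Fin.castSucc_injective d), Measure.map_map (WithLp.measurable_toLp 2 _) (by fun_prop)]
  rfl

/-- The vector with given first coordinates and last coordinate. -/
noncomputable def joinCoords (u : Euc d) (t : ℝ) : Euc (d + 1) :=
  WithLp.toLp 2 (Fin.snoc (α := fun _ => ℝ) u t)

theorem measurable_joinCoords : Measurable fun q : ℝ × Euc d => joinCoords q.2 q.1 := by
  refine (WithLp.measurable_toLp 2 _).comp (measurable_pi_lambda _ fun i => ?_)
  refine Fin.lastCases ?_ (fun j => ?_) i
  · simp only [Fin.snoc_last]; fun_prop
  · simp only [Fin.snoc_castSucc]; fun_prop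

theorem joinCoords_initCoords (p : Euc (d + 1)) : joinCoords (initCoords p) (p (Fin.last d)) = p := by
  ext i
  refine Fin.lastCases ?_ (fun j => ?_) i <;> simp [joinCoords, initCoords]

theorem smul_joinCoords (c : ℝ) (u : Euc d) (t : ℝ) :
    c • joinCoords u t = joinCoords (c • u) (c * t) := by
  ext i
  refine Fin.lastCases ?_ (fun j => ?_) i <;> simp [joinCoords]

theorem norm_sq_initCoords (p : Euc (d + 1)) :
    ‖initCoords p‖ ^ 2 = ‖p‖ ^ 2 - p (Fin.last d) ^ 2 := by
  rw [EuclideanSpace.real_norm_sq_eq, EuclideanSpace.real_norm_sq_eq, Fin.sum_univ_castSucc]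
  simp [initCoords]

theorem norm_inv_smul_smul {E : Type*} [NormedAddCommGroup E] [NormedSpace ℝ E] {c : ℝ} (hc : 0 < c)
    (p : E) : ‖c • p‖⁻¹ • (c • p) = ‖p‖⁻¹ • p := by
  rw [norm_smul, Real.norm_of_nonneg hc.le, smul_smul, mul_inv, mul_right_comm,
    inv_mul_cancel₀ hc.ne', one_mul]

/-- A density on `ℝ^(d+1)`, at points with scalar product `t` with `z` and squared norm `n`, whose
radial projection to the sphere is `Q_S(z, ·)`. -/
noncomputable def coneDensity (d : ℕ) (h t n : ℝ) : ℝ≥0∞ :=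
  (Set.Ioo (0 : ℝ) 1).indicator 1 t *
    (ENNReal.ofReal |((h * t) ^ d)⁻¹| * gaussianDensity d ((n - t ^ 2) / (h * t) ^ 2))

theorem measurable_coneDensity (d : ℕ) (h : ℝ) :
    Measurable fun q : ℝ × ℝ => coneDensity d h q.1 q.2 := by
  have h1 := measurable_gaussianDensity d
  have h2 : Measurable ((Set.Ioo (0 : ℝ) 1).indicator (1 : ℝ → ℝ≥0∞)) :=
    measurable_one.indicator measurableSet_Ioo
  unfold coneDensity
  fun_prop

/-- The last basis vector, as a point of the sphere. -/
noncomputable def northPole (d : ℕ) : Sph d := ⟨EuclideanSpace.single (Fin.last d) 1, by simp⟩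

theorem northPole_add_tangentPart (h : ℝ) (ξ : Euc (d + 1)) :
    (northPole d : Euc (d + 1)) + tangentPart (northPole d) (h • ξ)
      = joinCoords (h • initCoords ξ) 1 := by
  ext i
  refine Fin.lastCases ?_ (fun j => ?_) i <;>
    simp [northPole, tangentPart, joinCoords, initCoords, EuclideanSpace.inner_single_left,
      Fin.castSucc_ne_last]

/-- From the pole the unnormalised step is `(h u, 1)` with `u` standard Gaussian on `ℝ^d`. Radial
projection ignores scaling, so the vector may be multiplied by any `t`; averaging over `t` uniform
in `(0, 1)` spreads its law from a hyperplane to a density on `ℝ^(d+1)`. -/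
theorem lintegral_sphereStep_northPole {h : ℝ} (hh : 0 < h) {F : Euc (d + 1) → ℝ≥0∞}
    (hF : Measurable F) :
    ∫⁻ ξ, F (sphereStep (northPole d) ξ) ∂(gaussianStep (d + 1) h)
      = ∫⁻ p : Euc (d + 1), coneDensity d h (p (Fin.last d)) (‖p‖ ^ 2) * F (‖p‖⁻¹ • p) := by
  have hstep : Measurable fun ξ : Euc (d + 1) => F (sphereStep (northPole d) ξ) :=
    hF.comp (measurable_subtype_coe.comp (measurable_sphereStep_right _))
  have hdir : Measurable fun p : Euc (d + 1) => F (‖p‖⁻¹ • p) := hF.comp (by fun_prop)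
  have hinit : Measurable (initCoords (d := d)) := (measurePreserving_last_initCoords d).measurable.snd
  have hgd := measurable_gaussianDensity d
  have hjoin : ∀ t : ℝ, Measurable fun u : Euc d => joinCoords u t := fun t =>
    measurable_joinCoords.comp measurable_prodMk_left
  have hH : Measurable fun u : Euc d => F (‖joinCoords (h • u) 1‖⁻¹ • joinCoords (h • u) 1) :=
    hdir.comp ((hjoin 1).comp (by fun_prop))
  have h1 : ∫⁻ ξ, F (sphereStep (northPole d) ξ) ∂(gaussianStep (d + 1) h)
      = ∫⁻ u : Euc d, gaussianDensity d (‖u‖ ^ 2) *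
        F (‖joinCoords (h • u) 1‖⁻¹ • joinCoords (h • u) 1) := by
    have hgd' : Measurable fun u : Euc d => gaussianDensity d (‖u‖ ^ 2) := by fun_prop
    rw [gaussianStep, lintegral_map hstep (by fun_prop)]
    have h2 : ∀ ξ : Euc (d + 1), F (sphereStep (northPole d) (h • ξ))
        = (fun u : Euc d => F (‖joinCoords (h • u) 1‖⁻¹ • joinCoords (h • u) 1))
          (initCoords ξ) := fun ξ => by
      simp only [sphereStep, northPole_add_tangentPart]
    rw [lintegral_congr h2, ← lintegral_map hH hinit, stdGaussian_map_initCoords,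
      stdGaussian_eq_withDensity, lintegral_withDensity_eq_lintegral_mul _ hgd' hH]
    rfl
  -- The slice at height `t`: substituting `h t u` for `u` gives the Gaussian of standard deviation
  -- `h t`, and the integral does not depend on `t`.
  have h3 : ∀ t ∈ Set.Ioo (0 : ℝ) 1,
      ∫⁻ ξ, F (sphereStep (northPole d) ξ) ∂(gaussianStep (d + 1) h)
      = ∫⁻ u : Euc d, ENNReal.ofReal |((h * t) ^ d)⁻¹| *
        (gaussianDensity d (‖u‖ ^ 2 / (h * t) ^ 2) * F (‖joinCoords u t‖⁻¹ • joinCoords u t)) := by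
    intro t ht
    have hht : 0 < h * t := mul_pos hh ht.1
    have hK : Measurable fun u : Euc d =>
        gaussianDensity d (‖u‖ ^ 2 / (h * t) ^ 2) * F (‖joinCoords u t‖⁻¹ • joinCoords u t) := by
      have := hdir.comp (hjoin t)
      exact Measurable.mul (by fun_prop) this
    have h4 := Measure.map_addHaar_smul (volume : Measure (Euc d)) hht.ne'
    rw [finrank_euclideanSpace, Fintype.card_fin] at h4
    rw [lintegral_const_mul _ hK, ← smul_eq_mul, ← lintegral_smul_measure, ← h4,
      lintegral_map hK (by fun_prop), h1]
    refine lintegral_congr fun u => ?_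
    have h5 : joinCoords ((h * t) • u) t = t • joinCoords (h • u) 1 := by
      rw [smul_joinCoords, mul_one, smul_smul, mul_comm]
    rw [h5, norm_inv_smul_smul ht.1, norm_smul, mul_pow, Real.norm_of_nonneg hht.le,
      mul_div_cancel_left₀ _ (pow_ne_zero 2 hht.ne')]
  have hG : Measurable fun q : ℝ × Euc d =>
      (Set.Ioo (0 : ℝ) 1).indicator (1 : ℝ → ℝ≥0∞) q.1 *
      (ENNReal.ofReal |((h * q.1) ^ d)⁻¹| * (gaussianDensity d (‖q.2‖ ^ 2 / (h * q.1) ^ 2) *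
        F (‖joinCoords q.2 q.1‖⁻¹ • joinCoords q.2 q.1))) := by
    have h6 : Measurable ((Set.Ioo (0 : ℝ) 1).indicator (1 : ℝ → ℝ≥0∞)) :=
      measurable_one.indicator measurableSet_Ioo
    have h7 := hdir.comp (measurable_joinCoords (d := d))
    exact (h6.comp measurable_fst).mul (Measurable.mul (by fun_prop) (Measurable.mul (by fun_prop) h7))
  have h8 : ∀ p : Euc (d + 1), coneDensity d h (p (Fin.last d)) (‖p‖ ^ 2) * F (‖p‖⁻¹ • p)
      = (fun q : ℝ × Euc d => (Set.Ioo (0 : ℝ) 1).indicator (1 : ℝ → ℝ≥0∞) q.1 *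
      (ENNReal.ofReal |((h * q.1) ^ d)⁻¹| * (gaussianDensity d (‖q.2‖ ^ 2 / (h * q.1) ^ 2) *
        F (‖joinCoords q.2 q.1‖⁻¹ • joinCoords q.2 q.1)))) (p (Fin.last d), initCoords p) := by
    intro p
    simp only [joinCoords_initCoords, norm_sq_initCoords, coneDensity, mul_assoc]
  rw [lintegral_congr h8, (measurePreserving_last_initCoords d).lintegral_comp hG,
    Measure.volume_eq_prod, lintegral_prod _ hG.aemeasurable]
  have h9 : ∀ t : ℝ, (∫⁻ u : Euc d, (Set.Ioo (0 : ℝ) 1).indicator (1 : ℝ → ℝ≥0∞) t *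
      (ENNReal.ofReal |((h * t) ^ d)⁻¹| * (gaussianDensity d (‖u‖ ^ 2 / (h * t) ^ 2) *
        F (‖joinCoords u t‖⁻¹ • joinCoords u t))))
      = (Set.Ioo (0 : ℝ) 1).indicator
        (fun _ => ∫⁻ ξ, F (sphereStep (northPole d) ξ) ∂(gaussianStep (d + 1) h)) t := by
    intro t
    by_cases ht : t ∈ Set.Ioo (0 : ℝ) 1
    · simp only [Set.indicator_of_mem ht, Pi.one_apply, one_mul]
      exact (h3 t ht).symm
    · simp [Set.indicator_of_notMem ht]
  rw [lintegral_congr h9, lintegral_indicator_const measurableSet_Ioo]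
  simp

theorem exists_linearIsometryEquiv_northPole (z : Sph d) :
    ∃ U : Euc (d + 1) ≃ₗᵢ[ℝ] Euc (d + 1), U (northPole d) = z :=
  ⟨_, Submodule.reflection_sub (v := (northPole d : Euc (d + 1))) (w := z) (by simp)⟩

/-- A reflection carries the pole to `z`. It preserves the Gaussian and Lebesgue measures, norms and
scalar products, and commutes with the step. -/
theorem lintegral_sphereStep {h : ℝ} (hh : 0 < h) (z : Sph d) {F : Euc (d + 1) → ℝ≥0∞}
    (hF : Measurable F) :
    ∫⁻ ξ, F (sphereStep z ξ) ∂(gaussianStep (d + 1) h)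
      = ∫⁻ p : Euc (d + 1), coneDensity d h (inner ℝ p (z : Euc (d + 1))) (‖p‖ ^ 2) *
        F (‖p‖⁻¹ • p) := by
  obtain ⟨U, hU⟩ := exists_linearIsometryEquiv_northPole z
  have hUm : Measurable U := U.continuous.measurable
  have hinv : (gaussianStep (d + 1) h).map U = gaussianStep (d + 1) h := by
    have h1 := stdGaussian_map U
    rw [gaussianStep, Measure.map_map hUm (by fun_prop)]
    conv_rhs => rw [← h1, Measure.map_map (by fun_prop) hUm]
    congr 1
    funext ξ
    simp
  have hstep : ∀ ξ, (sphereStep z (U ξ) : Euc (d + 1)) = U (sphereStep (northPole d) ξ) := by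
    intro ξ
    have h2 : (z : Euc (d + 1)) + tangentPart z (U ξ)
        = U ((northPole d : Euc (d + 1)) + tangentPart (northPole d) ξ) := by
      simp only [tangentPart, map_add, map_sub, map_smul, hU]
      rw [← hU, U.inner_map_map, U.norm_map]
    simp only [sphereStep, h2, U.norm_map, map_smul]
  have hstepm : Measurable fun ξ : Euc (d + 1) => F (sphereStep z ξ) :=
    hF.comp (measurable_subtype_coe.comp (measurable_sphereStep_right _))
  have hcd := measurable_coneDensity d h
  have hG : Measurable fun p : Euc (d + 1) =>
      coneDensity d h (inner ℝ p (z : Euc (d + 1))) (‖p‖ ^ 2) * F (‖p‖⁻¹ • p) :=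
    (hcd.comp (f := fun p : Euc (d + 1) => (inner ℝ p (z : Euc (d + 1)), ‖p‖ ^ 2))
      (by fun_prop)).mul (hF.comp (by fun_prop))
  rw [← hinv, lintegral_map hstepm hUm]
  simp only [hstep]
  rw [lintegral_sphereStep_northPole hh (F := fun x => F (U x)) (hF.comp hUm),
    ← U.measurePreserving.lintegral_comp hG]
  refine lintegral_congr fun p => ?_
  have h3 : inner ℝ (U p) (z : Euc (d + 1)) = p (Fin.last d) := by
    rw [← hU, U.inner_map_map]
    simp [northPole, EuclideanSpace.inner_single_right]
  rw [h3, U.norm_map, map_smul]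

/-- The density of `Q_S(z, ·)` at points with scalar product `c` with `z`. -/
noncomputable def stepDensity (d : ℕ) (h c : ℝ) : ℝ≥0∞ :=
  ∫⁻ r in Set.Ioi (0 : ℝ), ENNReal.ofReal (r ^ d) * coneDensity d h (r * c) (r ^ 2)

theorem measurable_stepDensity (d : ℕ) (h : ℝ) : Measurable (stepDensity d h) := by
  refine Measurable.lintegral_prod_right' (f := fun q : ℝ × ℝ =>
    ENNReal.ofReal (q.2 ^ d) * coneDensity d h (q.2 * q.1) (q.2 ^ 2)) ?_
  exact Measurable.mul (by fun_prop) ((measurable_coneDensity d h).comp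
    (f := fun q : ℝ × ℝ => (q.2 * q.1, q.2 ^ 2)) (by fun_prop))

/-- Polar coordinates integrate the radius out of the cone density, the indicator of `B` depending
only on the direction. What matters is that the result is symmetric in `y` and `z`. -/
theorem QS_eq_withDensity {h : ℝ} (hh : 0 < h) (z : Sph d) :
    QS d h z = (surface d).withDensity
      fun y => stepDensity d h (inner ℝ (y : Euc (d + 1)) (z : Euc (d + 1))) := by
  ext B hB
  have hcoe : MeasurableSet ((↑) '' B : Set (Euc (d + 1))) :=
    (MeasurableEmbedding.subtype_coe Metric.isClosed_sphere.measurableSet).measurableSet_image.2 hB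
  have hmem : ∀ y : Sph d, ((↑) '' B : Set (Euc (d + 1))).indicator (1 : Euc (d + 1) → ℝ≥0∞) y
      = B.indicator 1 y := by
    intro y
    by_cases hy : y ∈ B
    · simp [hy]
    · simp [hy]
  have hF : Measurable (((↑) '' B : Set (Euc (d + 1))).indicator (1 : Euc (d + 1) → ℝ≥0∞)) :=
    measurable_one.indicator hcoe
  have h1 : QS d h z B = ∫⁻ ξ, ((↑) '' B : Set (Euc (d + 1))).indicator (1 : Euc (d + 1) → ℝ≥0∞)
      (sphereStep z ξ) ∂(gaussianStep (d + 1) h) := by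
    change (gaussianStep (d + 1) h).map (sphereStep z) B = _
    rw [← lintegral_indicator_one hB, lintegral_map (measurable_one.indicator hB)
      (measurable_sphereStep_right z)]
    simp only [hmem]
  have hG : Measurable fun p : Euc (d + 1) =>
      coneDensity d h (inner ℝ p (z : Euc (d + 1))) (‖p‖ ^ 2) *
        ((↑) '' B : Set (Euc (d + 1))).indicator (1 : Euc (d + 1) → ℝ≥0∞) (‖p‖⁻¹ • p) :=
    ((measurable_coneDensity d h).comp
      (f := fun p : Euc (d + 1) => (inner ℝ p (z : Euc (d + 1)), ‖p‖ ^ 2))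
      (by fun_prop)).mul (hF.comp (by fun_prop))
  rw [h1, lintegral_sphereStep hh z hF, lintegral_polar d hG, withDensity_apply _ hB,
    ← lintegral_indicator hB]
  refine lintegral_congr fun y => ?_
  have h2 : ∀ r ∈ Set.Ioi (0 : ℝ), ENNReal.ofReal (r ^ d) *
      (coneDensity d h (inner ℝ (r • (y : Euc (d + 1))) (z : Euc (d + 1)))
        (‖r • (y : Euc (d + 1))‖ ^ 2) * ((↑) '' B : Set (Euc (d + 1))).indicator (1 : Euc (d + 1) → ℝ≥0∞)
        (‖r • (y : Euc (d + 1))‖⁻¹ • (r • (y : Euc (d + 1)))))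
      = ENNReal.ofReal (r ^ d) *
        coneDensity d h (r * inner ℝ (y : Euc (d + 1)) (z : Euc (d + 1))) (r ^ 2) *
        B.indicator 1 y := by
    intro r hr
    have hy : ‖(y : Euc (d + 1))‖ = 1 := by simp
    rw [norm_inv_smul_smul hr, norm_smul, hy, inv_one, one_smul, hmem, inner_smul_left, mul_one,
      Real.norm_of_nonneg (le_of_lt hr), conj_trivial, mul_assoc]
  have h3 : Measurable fun r : ℝ => ENNReal.ofReal (r ^ d) *
      coneDensity d h (r * inner ℝ (y : Euc (d + 1)) (z : Euc (d + 1))) (r ^ 2) :=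
    Measurable.mul (by fun_prop) ((measurable_coneDensity d h).comp
      (f := fun r : ℝ => (r * inner ℝ (y : Euc (d + 1)) (z : Euc (d + 1)), r ^ 2)) (by fun_prop))
  rw [setLIntegral_congr_fun measurableSet_Ioi h2, lintegral_mul_const _ h3]
  by_cases hy : y ∈ B
  · simp [hy, stepDensity]
  · simp [hy]

end ProposalDensity

end SMTM

namespace SMTM

/-! ### Symmetry of the proposal density and the ideal scheme. -/

section IdealScheme

variable {d : ℕ} {R h : ℝ} {π : Euc d → ℝ≥0} {ω : Sph d → Sph d → ℝ≥0}

theorem QS_absolutelyContinuous (hh : 0 < h) (z : Sph d) : QS d h z ≪ surface d := by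
  rw [QS_eq_withDensity hh z]
  exact withDensity_absolutelyContinuous _ _

theorem qS_ae_eq (hh : 0 < h) (z : Sph d) :
    qS d h z =ᵐ[surface d]
      fun y => stepDensity d h (inner ℝ (y : Euc (d + 1)) (z : Euc (d + 1))) := by
  have h1 := Kernel.rnDeriv_eq_rnDeriv_measure (κ := QS d h)
    (η := Kernel.const (Sph d) (surface d)) (a := z)
  have h2 : Measurable fun y : Sph d =>
      stepDensity d h (inner ℝ (y : Euc (d + 1)) (z : Euc (d + 1))) :=
    (measurable_stepDensity d h).comp (by fun_prop)
  have h3 := Measure.rnDeriv_withDensity (surface d) h2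
  rw [← QS_eq_withDensity hh z] at h3
  exact h1.trans h3

theorem QS_eq_withDensity_qS (hh : 0 < h) (z : Sph d) :
    QS d h z = (surface d).withDensity (qS d h z) := by
  rw [QS_eq_withDensity hh z]
  exact withDensity_congr_ae (qS_ae_eq hh z).symm

/-- As a Radon-Nikodym derivative, `qS` is determined only up to null sets for each `z`. Fubini
gives its equality with the symmetric version almost everywhere on the product, and this set is
intersected with its image under the swap. -/
theorem ae_qS_comm (hh : 0 < h) :
    ∀ᵐ z ∂(surface d), ∀ᵐ y ∂(surface d), qS d h z y = qS d h y z := by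
  have hs : Measurable fun p : Sph d × Sph d =>
      stepDensity d h (inner ℝ (p.2 : Euc (d + 1)) (p.1 : Euc (d + 1))) :=
    (measurable_stepDensity d h).comp (by fun_prop)
  have h1 : ∀ᵐ p ∂((surface d).prod (surface d)),
      qS d h p.1 p.2 = stepDensity d h (inner ℝ (p.2 : Euc (d + 1)) (p.1 : Euc (d + 1))) :=
    (Measure.ae_prod_iff_ae_ae (measurableSet_eq_fun (measurable_qS_uncurry d h) hs)).2
      (ae_of_all _ fun z => qS_ae_eq hh z)
  have h2 := (Measure.measurePreserving_swap (μ := surface d)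
    (ν := surface d)).quasiMeasurePreserving.ae h1
  have h3 : ∀ᵐ p ∂((surface d).prod (surface d)), qS d h p.1 p.2 = qS d h p.2 p.1 := by
    filter_upwards [h1, h2] with p hp hp'
    rw [hp, real_inner_comm]
    exact hp'.symm
  exact Measure.ae_ae_of_ae_prod h3

theorem meanWeight_eq_lintegral_surface (hh : 0 < h) (hω : Measurable (Function.uncurry ω))
    (z : Sph d) : meanWeight h ω z = ∫⁻ u, ω z u * qS d h z u ∂(surface d) := by
  have hm : Measurable fun y => (ω z y : ℝ≥0∞) :=
    measurable_weight hω measurable_const measurable_id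
  rw [meanWeight, QS_eq_withDensity_qS hh z, lintegral_withDensity_eq_lintegral_mul _
    (measurable_qS d h z) hm]
  exact lintegral_congr fun y => mul_comm _ _

theorem qInf_eq (hh : 0 < h) (hω : Measurable (Function.uncurry ω)) (z y : Sph d) :
    qInf h ω z y = ω z y * qS d h z y / meanWeight h ω z := by
  rw [meanWeight_eq_lintegral_surface hh hω]
  rfl

theorem measurable_qInf (hh : 0 < h) (hω : Measurable (Function.uncurry ω)) {α : Type*}
    [MeasurableSpace α] {f g : α → Sph d} (hf : Measurable f) (hg : Measurable g) :
    Measurable fun a => qInf h ω (f a) (g a) := by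
  simp only [qInf_eq hh hω]
  have h1 : Measurable fun a => qS d h (f a) (g a) :=
    (measurable_qS_uncurry d h).comp (hf.prodMk hg)
  exact ((measurable_weight hω hf hg).mul h1).div ((measurable_meanWeight h hω).comp hf)

theorem measurable_idealDensity (hh : 0 < h) (hπ : Measurable π)
    (hω : Measurable (Function.uncurry ω)) :
    Measurable (Function.uncurry fun z y => qInf h ω z y * idealAccept R h π ω z y) := by
  have hp := measurable_piS R hπ
  have h1 : Measurable fun p : Sph d × Sph d => qInf h ω p.1 p.2 :=
    measurable_qInf hh hω measurable_fst measurable_snd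
  have h2 : Measurable fun p : Sph d × Sph d => qInf h ω p.2 p.1 :=
    measurable_qInf hh hω measurable_snd measurable_fst
  unfold idealAccept
  exact h1.mul (measurable_const.min (((hp.comp measurable_snd).mul h2).div
    ((hp.comp measurable_fst).mul h1)))

theorem idealMove_apply (hh : 0 < h) (hπ : Measurable π) (hω : Measurable (Function.uncurry ω))
    (z : Sph d) : idealMove R h π ω z
      = (surface d).withDensity fun y => qInf h ω z y * idealAccept R h π ω z y := by
  rw [idealMove, Kernel.withDensity_apply _ (measurable_idealDensity hh hπ hω)]
  rfl

/-- Symmetry of the proposal density cancels it from the acceptance probability of the ideal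
scheme. -/
theorem idealMove_eq_withDensity_QS (hh : 0 < h) (hπ : Measurable π)
    (hω : Measurable (Function.uncurry ω)) {z : Sph d}
    (hz : ∀ᵐ y ∂(surface d), qS d h z y = qS d h y z) :
    idealMove R h π ω z = (QS d h z).withDensity (limitDensity R h π ω z) := by
  rw [idealMove_apply hh hπ hω, QS_eq_withDensity_qS hh z,
    ← withDensity_mul _ (measurable_qS d h z) (measurable_limitDensity R h hπ hω z)]
  refine withDensity_congr_ae ?_
  have htop : ∀ᵐ y ∂(surface d), qS d h z y ≠ ∞ :=
    Kernel.rnDeriv_ne_top (QS d h) (Kernel.const (Sph d) (surface d)) (a := z)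
  filter_upwards [hz, htop] with y hy hy'
  simp only [Pi.mul_apply, limitDensity, limitAccept, idealAccept, qInf_eq hh hω, ← hy]
  set q := qS d h z y
  -- The factor `q` cancels from the ratio only if nonzero and finite; if it is zero, both densities
  -- vanish.
  by_cases hq : q = 0
  · simp [hq]
  have h1 : piS R π y * (ω y z * q / meanWeight h ω y)
      = q * (piS R π y * ω y z / meanWeight h ω y) := by
    simp only [div_eq_mul_inv]; ring
  have h2 : piS R π z * (ω z y * q / meanWeight h ω z)
      = q * (piS R π z * ω z y / meanWeight h ω z) := by
    simp only [div_eq_mul_inv]; ring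
  rw [h1, h2, ENNReal.mul_div_mul_left _ _ hq hy']
  simp only [div_eq_mul_inv]
  ring

/-- Moves to points of zero target density are rejected. -/
theorem idealMove_absolutelyContinuous (hh : 0 < h) (hπ : Measurable π)
    (hω : Measurable (Function.uncurry ω)) (z : Sph d) :
    idealMove R h π ω z ≪ sphereTargetLaw R π := by
  refine Measure.AbsolutelyContinuous.mk fun C hC hC0 => ?_
  rw [sphereTargetLaw, withDensity_apply _ hC, lintegral_eq_zero_iff (measurable_piS R hπ)] at hC0
  rw [idealMove_apply hh hπ hω, withDensity_apply _ hC]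
  refine (lintegral_congr_ae ?_).trans lintegral_zero
  filter_upwards [hC0] with y hy
  have hy' : piS R π y = 0 := hy
  simp [idealAccept, hy']

end IdealScheme

/-! ### Transfer of the target between `ℝ^d` and the sphere. -/

section TargetOnSphere

variable {d : ℕ} {R : ℝ} {π : Euc d → ℝ≥0}

theorem lintegral_surface (hd : 1 ≤ d) (hR : 0 < R) {f : Sph d → ℝ≥0∞} (hf : Measurable f) :
    ∫⁻ z, f z ∂(surface d)
      = ∫⁻ x : Euc d, ENNReal.ofReal (conformalFactor R x ^ d) * f (stereoInv hR x) := by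
  have hcm : Measurable fun x : Euc d => ENNReal.ofReal (conformalFactor R x ^ d) :=
    (measurable_conformalFactor.pow_const d).ennreal_ofReal
  have hfc : Measurable fun x => f (stereoInv hR x) := hf.comp (measurable_stereoInv hR)
  rw [surface_eq_map_stereoInv hd hR, lintegral_map hf (measurable_stereoInv hR),
    lintegral_withDensity_eq_lintegral_mul _ hcm hfc]
  rfl

/-- The factor `(R² + ‖x‖²)^d` in the transferred density undoes the Jacobian of `SP⁻¹`, up to the
constant `(2R)^d`, which is therefore the normalising constant. -/
theorem conformalFactor_mul_piSUnnorm (hR : 0 < R) (π : Euc d → ℝ≥0) (x : Euc d) :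
    ENNReal.ofReal (conformalFactor R x ^ d) * piSUnnorm R π (stereoInv hR x)
      = ENNReal.ofReal ((2 * R) ^ d) * π x := by
  have hpos : 0 < ‖x‖ ^ 2 + R ^ 2 := by positivity
  rw [piSUnnorm, stereo_stereoInv, mul_left_comm, ← ENNReal.ofReal_mul
    (pow_nonneg (conformalFactor_pos hR x).le d), ← mul_pow, conformalFactor, add_comm (R ^ 2),
    div_mul_cancel₀ _ hpos.ne', mul_comm]

theorem lintegral_piSUnnorm (hd : 1 ≤ d) (hR : 0 < R) (hπ : Measurable π)
    [IsProbabilityMeasure (targetLaw π)] :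
    ∫⁻ z, piSUnnorm R π z ∂(surface d) = ENNReal.ofReal ((2 * R) ^ d) := by
  rw [lintegral_surface hd hR (measurable_piSUnnorm R hπ)]
  simp only [conformalFactor_mul_piSUnnorm]
  have h1 : ∫⁻ x, (π x : ℝ≥0∞) = 1 := by
    rw [← setLIntegral_univ, ← withDensity_apply _ MeasurableSet.univ]
    exact measure_univ (μ := targetLaw π)
  rw [lintegral_const_mul _ hπ.coe_nnreal_ennreal, h1, mul_one]

theorem piS_ne_top (hd : 1 ≤ d) (hR : 0 < R) (hπ : Measurable π)
    [IsProbabilityMeasure (targetLaw π)] (z : Sph d) : piS R π z ≠ ∞ := by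
  rw [piS, lintegral_piSUnnorm hd hR hπ]
  refine ENNReal.div_ne_top (ENNReal.mul_ne_top ENNReal.coe_ne_top ENNReal.ofReal_ne_top) ?_
  simp only [ne_eq, ENNReal.ofReal_eq_zero, not_le]
  positivity

/-- The target distribution on the sphere is the image of the target distribution on `ℝ^d`. -/
theorem targetLaw_map_stereoInv (hd : 1 ≤ d) (hR : 0 < R) (hπ : Measurable π)
    [IsProbabilityMeasure (targetLaw π)] :
    (targetLaw π).map (stereoInv hR) = sphereTargetLaw R π := by
  ext B hB
  have hBm := measurable_stereoInv hR hB
  have hc0 : ENNReal.ofReal ((2 * R) ^ d) ≠ 0 := by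
    simp only [ne_eq, ENNReal.ofReal_eq_zero, not_le]
    positivity
  rw [Measure.map_apply (measurable_stereoInv hR) hB, targetLaw, withDensity_apply _ hBm,
    sphereTargetLaw, withDensity_apply _ hB, ← lintegral_indicator hB, ← lintegral_indicator hBm,
    lintegral_surface hd hR ((measurable_piS R hπ).indicator hB)]
  refine lintegral_congr fun x => ?_
  by_cases hx : stereoInv hR x ∈ B
  · have hx' : x ∈ stereoInv hR ⁻¹' B := hx
    rw [Set.indicator_of_mem hx, Set.indicator_of_mem hx', piS, lintegral_piSUnnorm hd hR hπ,
      ← mul_div_assoc, conformalFactor_mul_piSUnnorm, mul_comm,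
      ENNReal.mul_div_cancel_right hc0 ENNReal.ofReal_ne_top]
  · have hx' : x ∉ stereoInv hR ⁻¹' B := hx
    rw [Set.indicator_of_notMem hx, Set.indicator_of_notMem hx', mul_zero]

end TargetOnSphere

/-! ### Finiteness and positivity of weights from the moment assumptions. -/

section Moments

variable {d : ℕ} {R h : ℝ} {π : Euc d → ℝ≥0} {ω : Sph d → Sph d → ℝ≥0}

theorem ae_meanWeight_ne_top (hω : Measurable (Function.uncurry ω))
    (hω4 : ∫⁻ z, ∫⁻ y, (ω z y : ℝ≥0∞) ^ 4 ∂(QS d h z) ∂(sphereTargetLaw R π) < ∞) :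
    ∀ᵐ z ∂(sphereTargetLaw R π), meanWeight h ω z ≠ ∞ := by
  have hm : Measurable fun z => ∫⁻ y, (ω z y : ℝ≥0∞) ^ 4 ∂(QS d h z) :=
    Measurable.lintegral_kernel_prod_right' (κ := QS d h)
      ((measurable_weight hω measurable_fst measurable_snd).pow_const 4)
  filter_upwards [ae_lt_top hm hω4.ne] with z hz
  have hle : ∀ a : ℝ≥0∞, a ≤ 1 + a ^ 4 := by
    intro a
    rcases le_total a 1 with ha | ha
    · exact ha.trans le_self_add
    · exact (le_self_pow₀ ha four_ne_zero).trans le_add_self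
  refine ((lintegral_mono fun y => hle (ω z y)).trans_lt ?_).ne
  rw [lintegral_add_left measurable_const]
  simpa using hz

/-- A zero weight has infinite inverse fourth power, so it can occur only on a null set. -/
theorem ae_ae_weight_ne_zero (hω : Measurable (Function.uncurry ω))
    (hω4' : ∫⁻ z, ∫⁻ y, ((ω z y : ℝ≥0∞)⁻¹) ^ 4 ∂(QS d h z) ∂(sphereTargetLaw R π) < ∞) :
    ∀ᵐ z ∂(sphereTargetLaw R π), ∀ᵐ y ∂(QS d h z), ω z y ≠ 0 := by
  have hm' : Measurable fun p : Sph d × Sph d => ((ω p.1 p.2 : ℝ≥0∞)⁻¹) ^ 4 :=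
    (measurable_weight hω measurable_fst measurable_snd).inv.pow_const 4
  have hm : Measurable fun z => ∫⁻ y, ((ω z y : ℝ≥0∞)⁻¹) ^ 4 ∂(QS d h z) :=
    Measurable.lintegral_kernel_prod_right' (κ := QS d h) hm'
  filter_upwards [ae_lt_top hm hω4'.ne] with z hz
  filter_upwards [ae_lt_top (hm'.comp measurable_prodMk_left) hz.ne] with y hy h0
  simp [h0] at hy

theorem meanWeight_ne_zero (hω : Measurable (Function.uncurry ω)) {z : Sph d}
    (hz : ∀ᵐ y ∂(QS d h z), ω z y ≠ 0) : meanWeight h ω z ≠ 0 := by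
  intro h0
  have hm : Measurable fun y => (ω z y : ℝ≥0∞) :=
    measurable_weight hω measurable_const measurable_id
  rw [meanWeight, lintegral_eq_zero_iff hm] at h0
  have : ∀ᵐ y ∂(QS d h z), False := by
    filter_upwards [hz, h0] with y hy hy'
    exact hy (by simpa using hy')
  rw [ae_iff] at this
  simp at this

end Moments

/-! ### Bounded convergence under projection and rejection. -/

section Rejection

variable {α β : Type*} [MeasurableSpace α] [MeasurableSpace β]

theorem BoundedlyConvergesTo.map {κ : ℕ → Measure α} {ν : Measure α}
    (hκ : BoundedlyConvergesTo κ ν) {f : α → β} (hf : Measurable f) :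
    BoundedlyConvergesTo (fun n => (κ n).map f) (ν.map f) := by
  intro g g' hg hg' hle hlim
  simp only [lintegral_map (hg _) hf, lintegral_map hg' hf]
  exact hκ _ _ (fun n => (hg n).comp hf) (hg'.comp hf) (fun n x => hle n _)
    (ae_of_ae_map hf.aemeasurable hlim)

theorem lintegral_withRejection (M : Kernel α α) (x : α) {g : α → ℝ≥0∞} (hg : Measurable g) :
    ∫⁻ y, g y ∂(withRejection M x) = ∫⁻ y, g y ∂(M x) + (1 - M x Set.univ) * g x := by
  change ∫⁻ y, g y ∂(M x + (1 - M x Set.univ) • Measure.dirac x) = _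
  rw [lintegral_add_measure, lintegral_smul_measure, lintegral_dirac' _ hg, smul_eq_mul]

/-- The test function `1` gives convergence of the accepted mass, hence of the rejection
probability. -/
theorem BoundedlyConvergesTo.withRejection {M : ℕ → Kernel α α} {M' : Kernel α α} {x : α}
    (hM : BoundedlyConvergesTo (fun n => M n x) (M' x)) :
    BoundedlyConvergesTo (fun n => withRejection (M n) x) (withRejection M' x) := by
  intro g g' hg hg' hle hlim
  simp only [lintegral_withRejection _ _ (hg _), lintegral_withRejection _ _ hg']
  have hmass : Tendsto (fun n => M n x Set.univ) atTop (𝓝 (M' x Set.univ)) := by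
    simpa using hM (fun _ _ => 1) (fun _ => 1) (fun _ => measurable_const) measurable_const
      (fun _ _ => le_rfl) (by simp)
  have hrej : Tendsto (fun n => 1 - M n x Set.univ) atTop (𝓝 (1 - M' x Set.univ)) :=
    ENNReal.Tendsto.sub tendsto_const_nhds hmass (Or.inl ENNReal.one_ne_top)
  have hlim' : ∀ᵐ y ∂(M' x + (1 - M' x Set.univ) • Measure.dirac x),
      Tendsto (fun n => g n y) atTop (𝓝 (g' y)) := hlim
  rw [ae_add_measure_iff] at hlim'
  refine (hM g g' hg hg' hle hlim'.1).add ?_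
  -- If the limit never rejects, nothing is known about `g n x`, but it is at most `1` and its
  -- coefficient tends to `0`. Otherwise `x` is an atom of the limit, so `g n x` converges.
  by_cases h0 : 1 - M' x Set.univ = 0
  · rw [h0] at hrej ⊢
    rw [zero_mul]
    exact tendsto_of_tendsto_of_tendsto_of_le_of_le tendsto_const_nhds hrej (fun _ => zero_le)
      fun n => mul_le_of_le_one_right zero_le (hle n x)
  · have hx := (ae_dirac_iff (measurableSet_tendsto_fun hg hg')).1
      ((Measure.ae_ennreal_smul_measure_iff h0).1 hlim'.2)
    have hx' : Tendsto (fun n => g n x) atTop (𝓝 (g' x)) := hx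
    have hgx : g' x ≠ ∞ := ((le_of_tendsto' hx' fun n => hle n x).trans_lt ENNReal.one_lt_top).ne
    exact ENNReal.Tendsto.mul hrej (Or.inr hgx) hx'
      (Or.inr (ENNReal.sub_ne_top ENNReal.one_ne_top))

theorem BoundedlyConvergesTo.pullback {d : ℕ} {R : ℝ} (hR : 0 < R)
    {M : ℕ → Kernel (Sph d) (Sph d)} {M' : Kernel (Sph d) (Sph d)} {x : Euc d}
    (hM : BoundedlyConvergesTo (fun n => M n (stereoInv hR x)) (M' (stereoInv hR x))) :
    BoundedlyConvergesTo (fun n => pullback hR (M n) x) (pullback hR M' x) := by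
  refine BoundedlyConvergesTo.withRejection ?_
  simp only [Kernel.comap_apply, Kernel.map_apply _ (measurable_stereo R)]
  exact hM.map (measurable_stereo R)

end Rejection

/-! ### Assembling the one-step convergence. -/

section Convergence

variable {d : ℕ} {R h : ℝ} {π : Euc d → ℝ≥0} {ω : Sph d → Sph d → ℝ≥0}

theorem ae_boundedlyConvergesTo_idealMove (hd : 1 ≤ d) (hR : 0 < R) (hh : 0 < h)
    (hπ : Measurable π) [IsProbabilityMeasure (targetLaw π)] (hω : Measurable (Function.uncurry ω))
    (hω4 : ∫⁻ z, ∫⁻ y, (ω z y : ℝ≥0∞) ^ 4 ∂(QS d h z) ∂(sphereTargetLaw R π) < ∞)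
    (hω4' : ∫⁻ z, ∫⁻ y, ((ω z y : ℝ≥0∞)⁻¹) ^ 4 ∂(QS d h z) ∂(sphereTargetLaw R π) < ∞) :
    ∀ᵐ z ∂(sphereTargetLaw R π),
      BoundedlyConvergesTo (fun N => smtmMove R h π ω N z) (idealMove R h π ω z) := by
  have hp := measurable_piS R hπ
  have hpos : ∀ᵐ z ∂(sphereTargetLaw R π), piS R π z ≠ 0 :=
    (ae_withDensity_iff hp).2 (ae_of_all _ fun z hz => hz)
  have htop := ae_meanWeight_ne_top (R := R) (π := π) hω hω4
  have hne := ae_ae_weight_ne_zero (R := R) (π := π) hω hω4'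
  have hsymm := (withDensity_absolutelyContinuous (surface d) (piS R π)).ae_le
    (ae_qS_comm (d := d) hh)
  -- Proposals are absolutely continuous with respect to the surface measure, but perhaps not to the
  -- target; hence the form conditional on `piS R π y ≠ 0`.
  have hboth : ∀ᵐ y ∂(surface d), piS R π y ≠ 0 →
      meanWeight h ω y ≠ 0 ∧ meanWeight h ω y ≠ ∞ := by
    refine (ae_withDensity_iff hp).1 ?_
    filter_upwards [htop, hne] with y hy hy'
    exact ⟨meanWeight_ne_zero hω hy', hy⟩
  filter_upwards [hpos, htop, hne, hsymm] with z hz hzt hzn hzs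
  rw [idealMove_eq_withDensity_QS hh hπ hω hzs]
  refine boundedlyConvergesTo_smtmMove hπ hω hz (piS_ne_top hd hR hπ z)
    (meanWeight_ne_zero hω hzn) hzt ?_
  filter_upwards [hzn, (QS_absolutelyContinuous hh z).ae_le hboth] with y hy hy'
  exact ⟨hy, hy'⟩

/-- Accepted moves do not charge the null set `B`, and a rejection ends in `B` only from a start in
`B`, whence the restriction to almost every `x`. -/
theorem ae_idealKernel_eq_zero (hd : 1 ≤ d) (hR : 0 < R) (hh : 0 < h) (hπ : Measurable π)
    [IsProbabilityMeasure (targetLaw π)] (hω : Measurable (Function.uncurry ω)) {B : Set (Euc d)}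
    (hB : MeasurableSet B) (hB0 : targetLaw π B = 0) :
    ∀ᵐ x ∂(targetLaw π), idealKernel hR h π hω x B = 0 := by
  filter_upwards [measure_eq_zero_iff_ae_notMem.1 hB0] with x hx
  have hsB : MeasurableSet (stereo R ⁻¹' B) := measurable_stereo R hB
  have h1 : sphereTargetLaw R π (stereo R ⁻¹' B) = 0 := by
    rw [← targetLaw_map_stereoInv hd hR hπ, Measure.map_apply (measurable_stereoInv hR) hsB,
      ← Set.preimage_comp]
    have h2 : stereo R ∘ stereoInv hR = (id : Euc d → Euc d) := funext (stereo_stereoInv hR)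
    rw [h2, Set.preimage_id, hB0]
  have h3 : idealMove R h π ω (stereoInv hR x) (stereo R ⁻¹' B) = 0 :=
    idealMove_absolutelyContinuous hh hπ hω _ h1
  rw [← lintegral_indicator_one hB, idealKernel, pullback,
    lintegral_withRejection _ _ (measurable_one.indicator hB), lintegral_indicator_one hB,
    Kernel.comap_apply, Kernel.map_apply' _ (measurable_stereo R) _ hB, h3,
    Set.indicator_of_notMem hx, mul_zero, add_zero]

end Convergence

end SMTM

theorem mainTheorem5 {d : ℕ} (hd : 1 ≤ d) {R : ℝ} (hR : 0 < R) {h : ℝ} (hh : 0 < h)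
    (π : SMTM.Euc d → ℝ≥0) (hπ : Measurable π) [IsProbabilityMeasure (SMTM.targetLaw π)]
    (ω : SMTM.Sph d → SMTM.Sph d → ℝ≥0) (hω : Measurable (Function.uncurry ω))
    (hω4 : ∫⁻ z, ∫⁻ y, (ω z y : ℝ≥0∞) ^ 4 ∂(SMTM.QS d h z) ∂(SMTM.sphereTargetLaw R π) < ∞)
    (hω4' : ∫⁻ z, ∫⁻ y, ((ω z y : ℝ≥0∞)⁻¹) ^ 4 ∂(SMTM.QS d h z) ∂(SMTM.sphereTargetLaw R π) < ∞) :
    Tendsto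
      (fun N : ℕ => SMTM.chainLaw (SMTM.targetLaw π) (SMTM.smtmKernel hR h π hω N))
      atTop
      (𝓝 (SMTM.chainLaw (SMTM.targetLaw π) (SMTM.idealKernel hR h π hω))) := by
  refine SMTM.tendsto_chainLaw
    (fun B hB hB0 => SMTM.ae_idealKernel_eq_zero hd hR hh hπ hω hB hB0) ?_
  have h1 := SMTM.ae_boundedlyConvergesTo_idealMove hd hR hh hπ hω hω4 hω4'
  -- The target on the sphere is the image of the target on `ℝ^d`, so the convergence at almost
  -- every `z` holds at `SP⁻¹(x)` for almost every `x`.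
  rw [← SMTM.targetLaw_map_stereoInv hd hR hπ] at h1
  filter_upwards [ae_of_ae_map (SMTM.measurable_stereoInv hR).aemeasurable h1] with x hx
  exact SMTM.BoundedlyConvergesTo.pullback hR hx
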